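/- Let $T\subset\mathbb R^2$ be a nondegenerate closed triangle with vertices $v_1,v_2,v_3$. Write $P_m(T)$ for the real polynomials of degree at most $m$ on $T$, $\mathbb S^2$ for the symmetric $2\times 2$ matrices, $n$ for a unit normal on each edge, and $\mathbf{RM}=\mathrm{span}\{(1,0)^T,(0,1)^T,(-y,x)^T\}$. For an integer $k\ge 1$ define \begin{align*} \mathring U_{k+2}(T)&=\{u\in P_{k+2}(T):\ \nabla^\alpha u(v_i)=0\ \text{for } |\alpha|\le 4,\ i=1,2,3;\ u|_{\partial T}=\tfrac{\partial u}{\partial n}|_{\partial T}=\tfrac{\partial^2u}{\partial n^2}|_{\partial T}=0\},\\ \mathring\Sigma_k(T)&=\{\sigma\in P_k(T;\mathbb S^2):\ \nabla^\alpha\sigma(v_i)=0\ \text{for } |\alpha|\le 2,\ i=1,2,3;\ \sigma|_{\partial T}=0\},\\ \mathring Q_{k-1}(T)&=\{q\in P_{k-1}(T;\mathbb R^2):\ \nabla^\alpha q(v_i)=0\ \text{for } |\alpha|\le 1,\ i=1,2,3\}, \end{align*} and let $\mathring Q_{k-1}(T)\cap\mathbf{RM}^\perp$ be the set of $q\in\mathring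 Q_{k-1}(T)$ with $\int_T q\cdot r\,dx=0$ for all $r\in\mathbf{RM}$. Let $\operatorname{curl}\operatorname{curl}^T u=\begin{pmatrix}u_{yy}&-u_{xy}\\-u_{xy}&u_{xx}\end{pmatrix}$ and let $\operatorname{div}$ be the row-wise divergence. (1) For every integer $k\ge 1$ and every triangle $T$, the sequence $$0\to\mathring U_{k+2}(T)\xrightarrow{\ \operatorname{curl}\operatorname{curl}^T\ }\mathring\Sigma_k(T)\xrightarrow{\ \operatorname{div}\ }\mathring Q_{k-1}(T)\cap\mathbf{RM}^\perp\to 0$$ is a well-defined complex and is exact. (2) Let $k\ge 7$ and $\kappa\in\mathbb R$. There is a constant $C$, depending only on $k$ and $\kappa$, such that for every triangle $T$ whose shape regularity constant (the diameter of $T$ divided by the diameter of its largest inscribed disc) is at most $\kappa$ there is a linear map $R:\mathring Q_{k-1}(T)\cap\mathbf{RM}^\perp\to\mathring\Sigma_k(T)$ such that, for all $q$, $$\operatorname{div}(Rq)=q,\qquad \|\nabla (Rq)\|_{L^2(T)}\le C\,\|q\|_{L^2(T)},\qquad \|Rq\|_{H^1(T)}\le C\,\max\{1,\operatorname{diam}T\}\,\|q\|_{L^2(T)}.$$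 Here $\|\sigma\|_{H^1(T)}^2=\|\sigma\|_{L^2(T)}^2+\|\nabla\sigma\|_{L^2(T)}^2$. -/

import Mathlib

open MeasureTheory

noncomputable section

namespace BubbleComplex

/-- The Euclidean plane. -/
abbrev Plane : Type := EuclideanSpace ℝ (Fin 2)

/-- Real polynomials in the two coordinates `x = X 0`, `y = X 1`. A triangle has nonempty interior,
so polynomials and polynomial functions on a triangle are identified. -/
abbrev Poly : Type := MvPolynomial (Fin 2) ℝ

/-- The value of a polynomial at a point of the plane. -/
def val (p : Poly) (x : Plane) : ℝ := MvPolynomial.eval (fun i => x i) p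

/-- The partial derivative `∂ / ∂ x_i`. -/
def partialD (i : Fin 2) : Module.End ℝ Poly := (MvPolynomial.pderiv i).toLinearMap

/-- The derivative `∇ ^ α` for the multi-index `α = (a, b)`. -/
def multiD (a b : ℕ) : Module.End ℝ Poly := partialD 0 ^ a * partialD 1 ^ b

/-- The two components of the scalar curl: `curl u = (∇ u)^⊥ = (∂u/∂y, -∂u/∂x)`. -/
def curlComp (i : Fin 2) : Module.End ℝ Poly := ![partialD 1, -partialD 0] i

/-- The Airy operator `curl curl^T`, that is `u ↦ [[u_yy, -u_xy], [-u_xy, u_xx]]`. -/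
def airy : Poly →ₗ[ℝ] Matrix (Fin 2) (Fin 2) Poly where
  toFun u := Matrix.of fun i j => curlComp i (curlComp j u)
  map_add' u v := by ext1 i j; simp
  map_smul' c u := by ext1 i j; simp

/-- The row-wise divergence of a matrix field. -/
def div : Matrix (Fin 2) (Fin 2) Poly →ₗ[ℝ] (Fin 2 → Poly) where
  toFun σ := fun i => ∑ j, partialD j (σ i j)
  map_add' σ τ := by ext1 i; simp [Finset.sum_add_distrib]
  map_smul' c σ := by ext1 i; simp

/-- A (nondegenerate) triangle in the plane, given by its three vertices. -/
abbrev Triangle : Type := Affine.Triangle ℝ Plane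

/-- The closed triangle as a set of points. -/
def region (T : Triangle) : Set Plane := convexHull ℝ (Set.range T.points)

/-- The closed edge opposite to the `i`-th vertex (indices modulo 3). The boundary of the triangle
is the union of the three edges. -/
def edge (T : Triangle) (i : Fin 3) : Set Plane := segment ℝ (T.points (i + 1)) (T.points (i + 2))

/-- The edge vector of the `i`-th edge. -/
def edgeVec (T : Triangle) (i : Fin 3) : Plane := T.points (i + 2) - T.points (i + 1)

/-- The unit normal `t^⊥` of the `i`-th edge, with `t` the unit tangent and `(a, b)^⊥ = (b, -a)`. -/
def edgeNormal (T : Triangle) (i : Fin 3) : Plane :=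
  ‖edgeVec T i‖⁻¹ • !₂[edgeVec T i 1, -edgeVec T i 0]

/-- The derivative `∂ / ∂n` in the direction of the unit normal of the `i`-th edge. -/
def normalD (T : Triangle) (i : Fin 3) : Module.End ℝ Poly :=
  edgeNormal T i 0 • partialD 0 + edgeNormal T i 1 • partialD 1

/-- All derivatives of `p` of order at most `m` vanish at every vertex of the triangle. -/
def VanishesAtVertices (T : Triangle) (m : ℕ) (p : Poly) : Prop :=
  ∀ (v : Fin 3) (a b : ℕ), a + b ≤ m → val (multiD a b p) (T.points v) = 0

/-- Polynomials of total degree at most `d`. -/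
abbrev polyDeg (d : ℕ) : Submodule ℝ Poly := MvPolynomial.restrictTotalDegree (Fin 2) ℝ d

theorem val_zero (x : Plane) : val 0 x = 0 := by simp [val]

theorem val_add (p q : Poly) (x : Plane) : val (p + q) x = val p x + val q x := by simp [val]

theorem val_smul (c : ℝ) (p : Poly) (x : Plane) : val (c • p) x = c * val p x := by
  simp [val, MvPolynomial.smul_eval]

theorem continuous_val (p : Poly) : Continuous (val p) := by
  unfold val
  exact (MvPolynomial.continuous_eval p).comp (by fun_prop)

theorem isCompact_region (T : Triangle) : IsCompact (region T) :=
  (Set.finite_range T.points).isCompact_convexHull (𝕜 := ℝ)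

theorem VanishesAtVertices.zero (T : Triangle) (m : ℕ) : VanishesAtVertices T m 0 := by
  intro v a b _
  simp [val_zero]

theorem VanishesAtVertices.add {T : Triangle} {m : ℕ} {p q : Poly}
    (hp : VanishesAtVertices T m p) (hq : VanishesAtVertices T m q) :
    VanishesAtVertices T m (p + q) := by
  intro v a b h
  rw [map_add, val_add, hp v a b h, hq v a b h, add_zero]

theorem VanishesAtVertices.smul {T : Triangle} {m : ℕ} {p : Poly} (c : ℝ)
    (hp : VanishesAtVertices T m p) : VanishesAtVertices T m (c • p) := by
  intro v a b h
  rw [map_smul, val_smul, hp v a b h, mul_zero]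

/-- The scalar bubbles of degree `d` (used with `d = k + 2`): all derivatives of order at most 4
vanish at the vertices, and `u`, `∂u/∂n`, `∂²u/∂n²` vanish on the boundary. -/
def bubbleU (T : Triangle) (d : ℕ) : Submodule ℝ Poly where
  carrier := {u | u ∈ polyDeg d ∧ VanishesAtVertices T 4 u ∧
    ∀ i, ∀ x ∈ edge T i,
      val u x = 0 ∧ val (normalD T i u) x = 0 ∧ val (normalD T i (normalD T i u)) x = 0}
  zero_mem' := ⟨zero_mem _, VanishesAtVertices.zero T 4, fun i x _ => by simp [val_zero]⟩
  add_mem' := by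
    rintro p q ⟨hp1, hp2, hp3⟩ ⟨hq1, hq2, hq3⟩
    refine ⟨add_mem hp1 hq1, hp2.add hq2, fun i x hx => ?_⟩
    obtain ⟨a1, a2, a3⟩ := hp3 i x hx
    obtain ⟨b1, b2, b3⟩ := hq3 i x hx
    simp only [map_add, val_add, a1, a2, a3, b1, b2, b3, add_zero, and_self]
  smul_mem' := by
    rintro c p ⟨hp1, hp2, hp3⟩
    refine ⟨Submodule.smul_mem _ c hp1, hp2.smul c, fun i x hx => ?_⟩
    obtain ⟨a1, a2, a3⟩ := hp3 i x hx
    simp only [map_smul, val_smul, a1, a2, a3, mul_zero, and_self]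

/-- The symmetric matrix bubbles of degree `k`: all derivatives of order at most 2 vanish at the
vertices, and `σ` vanishes on the boundary. -/
def bubbleSigma (T : Triangle) (k : ℕ) : Submodule ℝ (Matrix (Fin 2) (Fin 2) Poly) where
  carrier := {σ | σ.IsSymm ∧ ∀ i j, σ i j ∈ polyDeg k ∧ VanishesAtVertices T 2 (σ i j) ∧
    ∀ e, ∀ x ∈ edge T e, val (σ i j) x = 0}
  zero_mem' := ⟨Matrix.isSymm_zero, fun i j => ⟨zero_mem _, VanishesAtVertices.zero T 2,
    fun e x _ => by simp [val_zero]⟩⟩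
  add_mem' := by
    rintro σ τ ⟨hσ, hσ'⟩ ⟨hτ, hτ'⟩
    refine ⟨hσ.add hτ, fun i j => ?_⟩
    obtain ⟨a1, a2, a3⟩ := hσ' i j
    obtain ⟨b1, b2, b3⟩ := hτ' i j
    refine ⟨add_mem a1 b1, a2.add b2, fun e x hx => ?_⟩
    rw [Matrix.add_apply, val_add, a3 e x hx, b3 e x hx, add_zero]
  smul_mem' := by
    rintro c σ ⟨hσ, hσ'⟩
    refine ⟨hσ.smul c, fun i j => ?_⟩
    obtain ⟨a1, a2, a3⟩ := hσ' i j
    refine ⟨Submodule.smul_mem _ c a1, a2.smul c, fun e x hx => ?_⟩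
    rw [Matrix.smul_apply, val_smul, a3 e x hx, mul_zero]

/-- The vector bubbles of degree `d` (used with `d = k - 1`): values and first derivatives vanish
at the vertices. -/
def bubbleQ (T : Triangle) (d : ℕ) : Submodule ℝ (Fin 2 → Poly) where
  carrier := {q | ∀ i, q i ∈ polyDeg d ∧ VanishesAtVertices T 1 (q i)}
  zero_mem' := fun _ => ⟨zero_mem _, VanishesAtVertices.zero T 1⟩
  add_mem' := fun hp hq i => ⟨add_mem (hp i).1 (hq i).1, (hp i).2.add (hq i).2⟩
  smul_mem' := fun c _ hp i => ⟨Submodule.smul_mem _ c (hp i).1, (hp i).2.smul c⟩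

/-- The rigid motions `RM = span {(1, 0), (0, 1), (-y, x)}`. -/
def rigidMotions : Submodule ℝ (Fin 2 → Poly) :=
  Submodule.span ℝ {![1, 0], ![0, 1], ![-MvPolynomial.X 1, MvPolynomial.X 0]}

theorem integrableOn_dot (T : Triangle) (q r : Fin 2 → Poly) :
    IntegrableOn (fun x => ∑ i, val (q i) x * val (r i) x) (region T) := by
  have h : Continuous (fun x => ∑ i, val (q i) x * val (r i) x) :=
    continuous_finsetSum _ fun i _ => (continuous_val (q i)).mul (continuous_val (r i))
  exact h.continuousOn.integrableOn_compact (isCompact_region T)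

/-- The fields whose `RM`-moments on the triangle vanish: `∫_T q · r = 0` for all `r ∈ RM`. -/
def rmPerp (T : Triangle) : Submodule ℝ (Fin 2 → Poly) where
  carrier := {q | ∀ r ∈ rigidMotions, ∫ x in region T, ∑ i, val (q i) x * val (r i) x = 0}
  zero_mem' := fun r _ => by simp [val_zero]
  add_mem' := by
    intro p q hp hq r hr
    have h := integral_add (integrableOn_dot T p r) (integrableOn_dot T q r)
    rw [hp r hr, hq r hr, add_zero] at h
    rw [← h]
    simp only [Pi.add_apply, val_add, add_mul, Finset.sum_add_distrib]
  smul_mem' := by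
    intro c q hq r hr
    have h := integral_const_mul (μ := volume.restrict (region T)) c
      (fun x => ∑ i, val (q i) x * val (r i) x)
    rw [hq r hr, mul_zero] at h
    rw [← h]
    simp only [Pi.smul_apply, val_smul, mul_assoc, Finset.mul_sum]

/-- The `L²(T)` norm of a vector field. -/
def l2Norm (T : Triangle) (q : Fin 2 → Poly) : ℝ :=
  √(∫ x in region T, ∑ i, val (q i) x ^ 2)

/-- The `H¹(T)` seminorm `‖∇σ‖_{L²(T)}` of a matrix field. -/
def h1Seminorm (T : Triangle) (σ : Matrix (Fin 2) (Fin 2) Poly) : ℝ :=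
  √(∫ x in region T, ∑ i, ∑ j, ∑ l, val (partialD l (σ i j)) x ^ 2)

/-- The full `H¹(T)` norm `(‖σ‖²_{L²(T)} + ‖∇σ‖²_{L²(T)})^{1/2}` of a matrix field. -/
def h1Norm (T : Triangle) (σ : Matrix (Fin 2) (Fin 2) Poly) : ℝ :=
  √((∫ x in region T, ∑ i, ∑ j, val (σ i j) x ^ 2) + h1Seminorm T σ ^ 2)

/-- The shape regularity constant of the triangle (the ratio of its diameter to the diameter of its
largest inscribed ball) is at most `κ`. -/
def ShapeRegular (κ : ℝ) (T : Triangle) : Prop :=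
  ∃ (c : Plane) (r : ℝ), 0 < r ∧ Metric.closedBall c r ⊆ region T ∧
    Metric.diam (region T) ≤ κ * (2 * r)

end BubbleComplex

end

/-!
A symmetric divergence-free matrix field on the plane is the Airy tensor of a potential, unique up
to an affine function. Normalised at one vertex, the potential of a field in the bubble space
vanishes to second order along each edge in turn and to fourth order at the vertices, which is
exactness in the middle. Surjectivity onto the orthogonal complement of the
rigid motions is a dimension count with the cubic bubble `b`, the product of the barycentric
coordinates. Every potential in the bubble space is divisible by `b ^ 3`; the scalar entries of the
matrix bubbles contain `b * p` for all `p` vanishing at the vertices; Hermite interpolation at the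
vertices gives the dimension of the vector bubbles; and since `∫ b |r|² > 0` for `r ≠ 0`, the
products of `b` with the rigid motions meet their orthogonal complement only in `0`. The totals
agree. On one triangle a right inverse of the divergence is bounded because the spaces are
finite-dimensional; Piola transforms carry it to every other triangle, at the cost of powers of the
Jacobians, and the product of the Jacobian of an affine map with that of its inverse is controlled
by the shape regularity.
-/

noncomputable section

namespace BubbleComplex

open MvPolynomial

/-! ### Polynomials and their derivatives -/

theorem pderiv_comm {σ R : Type*} [CommSemiring R] (i j : σ) (p : MvPolynomial σ R) :
    pderiv i (pderiv j p) = pderiv j (pderiv i p) := by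
  classical
  ext m
  obtain rfl | hij := eq_or_ne i j
  · rfl
  · simp only [coeff_pderiv, Finsupp.add_apply, Finsupp.single_eq_of_ne hij,
      Finsupp.single_eq_of_ne hij.symm, add_zero]
    rw [add_right_comm]
    ring

theorem totalDegree_pderiv_le {σ R : Type*} [CommSemiring R] (i : σ) (p : MvPolynomial σ R) :
    (pderiv i p).totalDegree ≤ p.totalDegree - 1 := by
  refine Finset.sup_le fun m hm => ?_
  rw [mem_support_iff, coeff_pderiv] at hm
  have h := le_totalDegree (mem_support_iff.2 (left_ne_zero_of_mul hm))
  rw [Finsupp.sum_add_index' (fun _ => rfl) fun _ _ _ => rfl, Finsupp.sum_single_index rfl] at h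
  omega

theorem pderiv_homogeneousComponent {σ R : Type*} [CommSemiring R] (i : σ) (d : ℕ)
    (p : MvPolynomial σ R) :
    pderiv i (homogeneousComponent (d + 1) p) = homogeneousComponent d (pderiv i p) := by
  ext m
  have h : (m + Finsupp.single i 1).degree = m.degree + 1 := by simp
  simp only [coeff_pderiv, coeff_homogeneousComponent, h, add_left_inj, ite_mul, zero_mul]

theorem sum_homogeneousComponent_of_totalDegree_le {σ R : Type*} [CommSemiring R] {d : ℕ}
    {p : MvPolynomial σ R} (hp : p.totalDegree ≤ d) :
    ∑ n ∈ Finset.range (d + 1), homogeneousComponent n p = p := by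
  conv_rhs => rw [← sum_homogeneousComponent p]
  refine (Finset.sum_subset (Finset.range_mono (by lia)) fun n _ hn => ?_).symm
  exact homogeneousComponent_eq_zero _ _ (by simpa using hn)

-- On the homogeneous part of degree `n` the potential is `∑ i, x_i f_i / (n + 1)`, by Euler's
-- identity.
theorem exists_pderiv_eq_of_pderiv_eq_pderiv {σ K : Type*} [Finite σ] [Field K] [CharZero K]
    {d : ℕ} {f : σ → MvPolynomial σ K} (hf : ∀ i, f i ∈ restrictTotalDegree σ K d)
    (hclosed : ∀ i j, pderiv j (f i) = pderiv i (f j)) :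
    ∃ u ∈ restrictTotalDegree σ K (d + 1), ∀ i, pderiv i u = f i := by
  classical
  have := Fintype.ofFinite σ
  have hclosed' (n : ℕ) (i j : σ) : pderiv j (homogeneousComponent n (f i)) =
      pderiv i (homogeneousComponent n (f j)) := by
    cases n with
    | zero => simp only [homogeneousComponent_zero, pderiv_C]
    | succ n => simp only [pderiv_homogeneousComponent, hclosed i j]
  let u (n : ℕ) : MvPolynomial σ K := ∑ i, X i * homogeneousComponent n (f i)
  have hu_deg (n : ℕ) : (u n).IsHomogeneous (n + 1) := .sum _ _ _ fun i _ =>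
    add_comm n 1 ▸ (isHomogeneous_X K i).mul (homogeneousComponent_isHomogeneous n (f i))
  have hu (n : ℕ) (j : σ) : pderiv j (u n) = (n + 1) • homogeneousComponent n (f j) := by
    calc pderiv j (u n) = homogeneousComponent n (f j) +
          ∑ i, X i * pderiv i (homogeneousComponent n (f j)) := by
            simp [u, pderiv_X, Pi.single_apply, hclosed' n _ j, Finset.sum_add_distrib, add_comm]
      _ = (n + 1) • homogeneousComponent n (f j) := by
            rw [(homogeneousComponent_isHomogeneous n (f j)).sum_X_mul_pderiv, succ_nsmul']
  refine ⟨∑ n ∈ Finset.range (d + 1), ((n + 1 : ℕ) : K)⁻¹ • u n,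
    Submodule.sum_mem _ fun n hn => Submodule.smul_mem _ _ ?_, fun j => ?_⟩
  · exact (mem_restrictTotalDegree _ _ _).2
      ((hu_deg n).totalDegree_le.trans (by simpa [Nat.lt_succ_iff] using hn))
  · simp only [map_sum, Derivation.map_smul, hu, ← Nat.cast_smul_eq_nsmul K]
    rw [Finset.sum_congr rfl fun n _ => inv_smul_smul₀ (Nat.cast_ne_zero.2 n.succ_ne_zero) _]
    exact sum_homogeneousComponent_of_totalDegree_le ((mem_restrictTotalDegree _ _ _).1 (hf j))

attribute [local simp] val_zero val_add val_smul

section Poly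

variable (p q : Poly) (x : Plane)

@[simp]
theorem val_mul : val (p * q) x = val p x * val q x := by simp [val]

@[simp]
theorem val_neg : val (-p) x = -val p x := by simp [val]

@[simp]
theorem val_sub : val (p - q) x = val p x - val q x := by simp [val]

@[simp]
theorem val_one : val 1 x = 1 := by simp [val]

@[simp]
theorem val_pow (n : ℕ) : val (p ^ n) x = val p x ^ n := by simp [val]

@[simp]
theorem val_X (i : Fin 2) : val (X i) x = x i := by simp [val]

@[simp]
theorem val_C (c : ℝ) : val (C c) x = c := by simp [val]

@[simp]
theorem val_sum {ι : Type*} (s : Finset ι) (f : ι → Poly) :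
    val (∑ i ∈ s, f i) x = ∑ i ∈ s, val (f i) x := by simp [val]

variable {p} in
theorem eq_zero_of_forall_val_eq_zero (h : ∀ x, val p x = 0) : p = 0 :=
  MvPolynomial.funext fun y => by simpa [val] using h (WithLp.toLp 2 y)

variable (i j : Fin 2)

theorem partialD_apply : partialD i p = pderiv i p := rfl

theorem partialD_mul : partialD i (p * q) = partialD i p * q + p * partialD i q := by
  simp [partialD, mul_comm, add_comm]

@[simp]
theorem partialD_one : partialD i 1 = 0 := pderiv_one

@[simp]
theorem partialD_C (c : ℝ) : partialD i (C c) = 0 := pderiv_C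

@[simp]
theorem partialD_X : partialD i (X j) = if i = j then 1 else 0 := by
  simp [partialD_apply, pderiv_X, Pi.single_apply, eq_comm]

theorem partialD_comm : partialD i (partialD j p) = partialD j (partialD i p) :=
  pderiv_comm i j p

theorem multiD_zero_zero : multiD 0 0 p = p := by simp [multiD]

theorem multiD_partialD_zero (a b : ℕ) : multiD a b (partialD 0 p) = multiD (a + 1) b p := by
  have h : Commute (partialD 0) (partialD 1 ^ b) :=
    Commute.pow_right (LinearMap.ext fun p => partialD_comm p 0 1) b
  simp only [multiD, pow_succ, mul_assoc, h.eq, Module.End.mul_apply]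

theorem multiD_partialD_one (a b : ℕ) : multiD a b (partialD 1 p) = multiD a (b + 1) p := by
  simp only [multiD, pow_succ, Module.End.mul_apply]

end Poly

section PolyDeg

variable {d e : ℕ} {p q : Poly}

theorem mem_polyDeg : p ∈ polyDeg d ↔ p.totalDegree ≤ d := mem_restrictTotalDegree _ _ _

theorem polyDeg_mono (h : d ≤ e) (hp : p ∈ polyDeg d) : p ∈ polyDeg e :=
  mem_polyDeg.2 ((mem_polyDeg.1 hp).trans h)

theorem mul_mem_polyDeg (hp : p ∈ polyDeg d) (hq : q ∈ polyDeg e) : p * q ∈ polyDeg (d + e) :=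
  mem_polyDeg.2 ((totalDegree_mul p q).trans (add_le_add (mem_polyDeg.1 hp) (mem_polyDeg.1 hq)))

theorem pow_mem_polyDeg (hp : p ∈ polyDeg d) (n : ℕ) : p ^ n ∈ polyDeg (n * d) :=
  mem_polyDeg.2 ((totalDegree_pow p n).trans (Nat.mul_le_mul_left n (mem_polyDeg.1 hp)))

theorem C_mem_polyDeg (d : ℕ) (c : ℝ) : C c ∈ polyDeg d := by simp [mem_polyDeg]

theorem X_mem_polyDeg (i : Fin 2) : X i ∈ polyDeg 1 := by simp [mem_polyDeg]

theorem partialD_mem_polyDeg (hp : p ∈ polyDeg d) (i : Fin 2) : partialD i p ∈ polyDeg (d - 1) :=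
  mem_polyDeg.2 ((totalDegree_pderiv_le i p).trans (Nat.sub_le_sub_right (mem_polyDeg.1 hp) 1))

theorem exists_potential {f g : Poly} (hf : f ∈ polyDeg d) (hg : g ∈ polyDeg d)
    (h : partialD 1 f = partialD 0 g) (x : Plane) :
    ∃ u ∈ polyDeg (d + 1), val u x = 0 ∧ partialD 0 u = f ∧ partialD 1 u = g := by
  obtain ⟨u, hu, hfg⟩ := exists_pderiv_eq_of_pderiv_eq_pderiv (f := ![f, g])
    (Fin.forall_fin_two.2 ⟨hf, hg⟩) (by
      rw [Fin.forall_fin_two, Fin.forall_fin_two, Fin.forall_fin_two]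
      exact ⟨⟨rfl, h⟩, h.symm, rfl⟩)
  refine ⟨u - C (val u x), sub_mem hu (C_mem_polyDeg _ _), by simp, ?_, ?_⟩
  · rw [map_sub, partialD_C, sub_zero]
    exact hfg 0
  · rw [map_sub, partialD_C, sub_zero]
    exact hfg 1

end PolyDeg

section VanishesAtVertices

variable {T : Triangle} {m n : ℕ} {p q : Poly}

theorem VanishesAtVertices.mono (h : m ≤ n) (hp : VanishesAtVertices T n p) :
    VanishesAtVertices T m p :=
  fun v a b hab => hp v a b (hab.trans h)

theorem VanishesAtVertices.val_eq_zero (hp : VanishesAtVertices T m p) (v : Fin 3) :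
    val p (T.points v) = 0 := by
  simpa only [multiD_zero_zero] using hp v 0 0 m.zero_le

theorem VanishesAtVertices.partialD (hp : VanishesAtVertices T (m + 1) p) (i : Fin 2) :
    VanishesAtVertices T m (partialD i p) := by
  intro v a b hab
  fin_cases i
  · exact multiD_partialD_zero p a b ▸ hp v (a + 1) b (by lia)
  · exact multiD_partialD_one p a b ▸ hp v a (b + 1) (by lia)

theorem vanishesAtVertices_zero_iff :
    VanishesAtVertices T 0 p ↔ ∀ v, val p (T.points v) = 0 := by
  refine ⟨fun h => h.val_eq_zero, fun h v a b hab => ?_⟩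
  obtain ⟨rfl, rfl⟩ : a = 0 ∧ b = 0 := by lia
  rw [multiD_zero_zero, h]

theorem vanishesAtVertices_succ_iff :
    VanishesAtVertices T (m + 1) p ↔
      (∀ v, val p (T.points v) = 0) ∧ ∀ i, VanishesAtVertices T m (partialD i p) := by
  refine ⟨fun h => ⟨h.val_eq_zero, h.partialD⟩, fun ⟨h0, h1⟩ v a b hab => ?_⟩
  match a, b with
  | 0, 0 => rw [multiD_zero_zero, h0]
  | 0, b + 1 => exact multiD_partialD_one p 0 b ▸ h1 1 v 0 b (by lia)
  | a + 1, b => exact multiD_partialD_zero p a b ▸ h1 0 v a b (by lia)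

theorem VanishesAtVertices.sum {ι : Type*} {s : Finset ι} {f : ι → Poly}
    (h : ∀ i ∈ s, VanishesAtVertices T m (f i)) : VanishesAtVertices T m (∑ i ∈ s, f i) :=
  Finset.sum_induction f _ (fun _ _ => .add) (.zero T m) h

theorem VanishesAtVertices.mul_right (hp : VanishesAtVertices T m p) (q : Poly) :
    VanishesAtVertices T m (p * q) := by
  induction m generalizing p q with
  | zero => exact vanishesAtVertices_zero_iff.2 fun v => by simp [hp.val_eq_zero v]
  | succ m ih =>
    refine vanishesAtVertices_succ_iff.2 ⟨fun v => by simp [hp.val_eq_zero v], fun i => ?_⟩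
    exact partialD_mul p q i ▸ (ih (hp.partialD i) q).add (ih (hp.mono m.le_succ) _)

theorem VanishesAtVertices.mul_left (hp : VanishesAtVertices T m p) (q : Poly) :
    VanishesAtVertices T m (q * p) :=
  mul_comm p q ▸ hp.mul_right q

theorem VanishesAtVertices.mul {T : Triangle} {m n : ℕ} {p q : Poly}
    (hp : VanishesAtVertices T m p) (hq : VanishesAtVertices T n q) :
    VanishesAtVertices T (m + n + 1) (p * q) := by
  refine vanishesAtVertices_succ_iff.2 ⟨fun v => by simp [hp.val_eq_zero v], fun i => ?_⟩
  rw [partialD_mul]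
  refine .add ?_ ?_
  · match m, hp with
    | 0, _ => exact (hq.mul_left _).mono (zero_add n).le
    | m + 1, hp => exact ((hp.partialD i).mul hq).mono (by rw [Nat.add_right_comm])
  · match n, hq with
    | 0, _ => exact hp.mul_right _
    | n + 1, hq => exact hp.mul (hq.partialD i)
termination_by m + n

end VanishesAtVertices

/-! ### Restriction to lines and edges -/

theorem derivation_aeval {σ R A : Type*} [Fintype σ] [CommSemiring R] [CommSemiring A]
    [Algebra R A] (D : Derivation R A A) (f : σ → A) (p : MvPolynomial σ R) :
    D (aeval f p) = ∑ i, aeval f (pderiv i p) * D (f i) := by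
  classical
  induction p using MvPolynomial.induction_on with
  | C a => simp
  | add p q hp hq => simp only [map_add, hp, hq, add_mul, Finset.sum_add_distrib]
  | mul_X p k hp =>
    have hk : aeval f p * D (f k) = ∑ i, aeval f (p * pderiv i (X k)) * D (f i) := by
      rw [Finset.sum_eq_single k (fun i _ hi => by simp [pderiv_X_of_ne hi.symm]) (by simp)]
      simp
    simp only [map_mul, aeval_X, Derivation.leibniz, smul_eq_mul, hp, Finset.mul_sum, hk,
      ← Finset.sum_add_distrib, map_add]
    exact Finset.sum_congr rfl fun i _ => by ring

/-- The restriction of a polynomial to the line `s ↦ x + s d`. -/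
def lineRes (x d : Plane) : Poly →ₐ[ℝ] Polynomial ℝ :=
  aeval fun i => Polynomial.C (x i) + Polynomial.C (d i) * Polynomial.X

/-- The derivative in the direction `d`, so that `normalD T e = dirD (edgeNormal T e)`. -/
def dirD (d : Plane) : Module.End ℝ Poly := d 0 • partialD 0 + d 1 • partialD 1

theorem eval_lineRes (x d : Plane) (p : Poly) (s : ℝ) :
    (lineRes x d p).eval s = val p (x + s • d) := by
  induction p using MvPolynomial.induction_on with
  | C a => simp [lineRes]
  | add p q hp hq => simp [hp, hq]
  | mul_X p k hp =>
    rw [map_mul, Polynomial.eval_mul, hp, val_mul]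
    simp [lineRes, mul_comm s]

theorem derivative_lineRes (x d : Plane) (p : Poly) :
    Polynomial.derivative (lineRes x d p) = lineRes x d (dirD d p) := by
  refine (derivation_aeval Polynomial.derivative' _ p).trans ?_
  simp only [Fin.sum_univ_two, Polynomial.derivative'_apply, Polynomial.derivative_C,
    Polynomial.derivative_C_mul, Polynomial.derivative_X, zero_add,
    mul_one, dirD, LinearMap.add_apply, LinearMap.smul_apply, map_add, map_smul,
    Polynomial.smul_eq_C_mul, partialD_apply, lineRes]
  ring

theorem val_add_smul_of_lineRes_dirD {x d : Plane} {p : Poly} (h : lineRes x d (dirD d p) = 0)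
    (s : ℝ) : val p (x + s • d) = val p x := by
  rw [← derivative_lineRes] at h
  have hp := Polynomial.eq_C_of_derivative_eq_zero h
  have h0 := eval_lineRes x d p 0
  rw [hp, Polynomial.eval_C, zero_smul, add_zero] at h0
  rw [← eval_lineRes, hp, Polynomial.eval_C, h0]

theorem eq_zero_of_forall_partialD_eq_zero {p : Poly} (h : ∀ i, partialD i p = 0) {x : Plane}
    (hx : val p x = 0) : p = 0 := by
  refine eq_zero_of_forall_val_eq_zero fun y => ?_
  simpa [hx] using val_add_smul_of_lineRes_dirD (x := x) (d := y - x) (p := p)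
    (by simp [dirD, h]) 1

theorem dirD_add_smul (a b : ℝ) (d d' : Plane) :
    dirD (a • d + b • d') = a • dirD d + b • dirD d' := by
  simp only [dirD, PiLp.add_apply, PiLp.smul_apply, smul_eq_mul]
  module

theorem partialD_eq_dirD (i : Fin 2) : partialD i = dirD (EuclideanSpace.single i 1) := by
  fin_cases i <;> simp [dirD]

theorem dirD_comm (d d' : Plane) (p : Poly) : dirD d (dirD d' p) = dirD d' (dirD d p) := by
  simp only [dirD, LinearMap.add_apply, LinearMap.smul_apply, map_add, map_smul,
    partialD_comm p 0 1]
  module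

section Edge

variable {T : Triangle} {e : Fin 3} {p : Poly}

theorem points_add_one_mem_edge (T : Triangle) (e : Fin 3) : T.points (e + 1) ∈ edge T e :=
  left_mem_segment _ _ _

theorem points_add_two_mem_edge (T : Triangle) (e : Fin 3) : T.points (e + 2) ∈ edge T e :=
  right_mem_segment _ _ _

theorem edge_eq_image (T : Triangle) (e : Fin 3) :
    edge T e = (fun s : ℝ => T.points (e + 1) + s • edgeVec T e) '' Set.Icc 0 1 :=
  segment_eq_image' ℝ _ _

theorem edgeVec_ne_zero (T : Triangle) (e : Fin 3) : edgeVec T e ≠ 0 :=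
  sub_ne_zero.2 (T.independent.injective.ne (by decide +revert))

theorem exists_eq_smul_edgeVec_add_smul_edgeNormal (T : Triangle) (e : Fin 3) (w : Plane) :
    ∃ a b : ℝ, w = a • edgeVec T e + b • edgeNormal T e := by
  set t := edgeVec T e with ht
  have hnorm : ‖t‖ ≠ 0 := norm_ne_zero_iff.2 (edgeVec_ne_zero T e)
  have hsq : ‖t‖ ^ 2 = t 0 ^ 2 + t 1 ^ 2 := by simp [EuclideanSpace.norm_sq_eq]
  refine ⟨(w 0 * t 0 + w 1 * t 1) / ‖t‖ ^ 2, (w 0 * t 1 - w 1 * t 0) / ‖t‖, ?_⟩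
  ext i
  fin_cases i <;> simp [edgeNormal, ← ht] <;> field_simp <;> rw [hsq] <;> ring

/-- The ideal of the line through an edge. By `mem_edgeIdeal` it consists of the polynomials that
vanish on the edge itself. -/
def edgeIdeal (T : Triangle) (e : Fin 3) : Ideal Poly :=
  RingHom.ker (lineRes (T.points (e + 1)) (edgeVec T e))

theorem mem_edgeIdeal : p ∈ edgeIdeal T e ↔ ∀ x ∈ edge T e, val p x = 0 := by
  rw [edge_eq_image, Set.forall_mem_image, edgeIdeal, RingHom.mem_ker]
  simp only [← eval_lineRes]
  refine ⟨fun h s _ => by rw [h, Polynomial.eval_zero], fun h => ?_⟩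
  exact Polynomial.eq_zero_of_infinite_isRoot _ ((Set.Icc_infinite zero_lt_one).mono fun s => @h s)

theorem smul_mem_edgeIdeal (c : ℝ) (hp : p ∈ edgeIdeal T e) : c • p ∈ edgeIdeal T e :=
  (edgeIdeal T e).smul_of_tower_mem c hp

theorem dirD_edgeVec_mem_edgeIdeal (hp : p ∈ edgeIdeal T e) :
    dirD (edgeVec T e) p ∈ edgeIdeal T e := by
  rw [edgeIdeal, RingHom.mem_ker] at *
  rw [← derivative_lineRes, hp, Polynomial.derivative_zero]

theorem val_eq_of_dirD_mem_edgeIdeal (hp : dirD (edgeVec T e) p ∈ edgeIdeal T e) {x : Plane}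
    (hx : x ∈ edge T e) : val p x = val p (T.points (e + 1)) := by
  obtain ⟨s, -, rfl⟩ := edge_eq_image T e ▸ hx
  exact val_add_smul_of_lineRes_dirD hp s

theorem mem_edgeIdeal_of_forall_dirD_mem (hp : ∀ e, dirD (edgeVec T e) p ∈ edgeIdeal T e)
    (h0 : val p (T.points 0) = 0) (e : Fin 3) : p ∈ edgeIdeal T e := by
  have hvertex (e : Fin 3) : val p (T.points (e + 2)) = val p (T.points (e + 1)) :=
    val_eq_of_dirD_mem_edgeIdeal (hp e) (points_add_two_mem_edge T e)
  have h2 : val p (T.points 2) = 0 := (hvertex 1).symm.trans h0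
  have h1 : val p (T.points 1) = 0 := (hvertex 0).symm.trans h2
  refine mem_edgeIdeal.2 fun x hx => ?_
  rw [val_eq_of_dirD_mem_edgeIdeal (hp e) hx]
  fin_cases e
  exacts [h1, h2, h0]

theorem partialD_partialD_mem_edgeIdeal (h0 : p ∈ edgeIdeal T e)
    (h1 : normalD T e p ∈ edgeIdeal T e) (h2 : normalD T e (normalD T e p) ∈ edgeIdeal T e)
    (i j : Fin 2) : partialD i (partialD j p) ∈ edgeIdeal T e := by
  obtain ⟨a, b, hi⟩ := exists_eq_smul_edgeVec_add_smul_edgeNormal T e (EuclideanSpace.single i 1)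
  obtain ⟨c, d, hj⟩ := exists_eq_smul_edgeVec_add_smul_edgeNormal T e (EuclideanSpace.single j 1)
  have htt := dirD_edgeVec_mem_edgeIdeal (dirD_edgeVec_mem_edgeIdeal h0)
  have htn := dirD_edgeVec_mem_edgeIdeal h1
  have hnt : dirD (edgeNormal T e) (dirD (edgeVec T e) p) ∈ edgeIdeal T e :=
    dirD_comm (edgeVec T e) (edgeNormal T e) p ▸ htn
  simp only [partialD_eq_dirD, hi, hj, dirD_add_smul, LinearMap.add_apply, LinearMap.smul_apply,
    map_add, map_smul]
  exact add_mem
    (smul_mem_edgeIdeal _ (add_mem (smul_mem_edgeIdeal _ htt) (smul_mem_edgeIdeal _ hnt)))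
    (smul_mem_edgeIdeal _ (add_mem (smul_mem_edgeIdeal _ htn) (smul_mem_edgeIdeal _ h2)))

end Edge

/-! ### The Airy operator on bubbles -/

/-- The scalar polynomials of degree at most `k` satisfying the vertex and boundary conditions of
the entries of the matrix bubbles `bubbleSigma T k`. -/
def scalarBubble (T : Triangle) (k : ℕ) : Submodule ℝ Poly where
  carrier := {p | p ∈ polyDeg k ∧ VanishesAtVertices T 2 p ∧ ∀ e, p ∈ edgeIdeal T e}
  zero_mem' := ⟨zero_mem _, .zero T 2, fun _ => zero_mem _⟩
  add_mem' := fun hp hq => ⟨add_mem hp.1 hq.1, hp.2.1.add hq.2.1,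
    fun e => add_mem (hp.2.2 e) (hq.2.2 e)⟩
  smul_mem' := fun c _ hp => ⟨Submodule.smul_mem _ c hp.1, hp.2.1.smul c,
    fun e => smul_mem_edgeIdeal c (hp.2.2 e)⟩

section Airy

variable {T : Triangle} {d k : ℕ} {u : Poly} {σ : Matrix (Fin 2) (Fin 2) Poly}

theorem mem_bubbleSigma :
    σ ∈ bubbleSigma T k ↔ σ.IsSymm ∧ ∀ i j, σ i j ∈ scalarBubble T k := by
  simp only [bubbleSigma, scalarBubble, mem_edgeIdeal]
  rfl

theorem mem_bubbleU : u ∈ bubbleU T d ↔ u ∈ polyDeg d ∧ VanishesAtVertices T 4 u ∧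
    ∀ e, u ∈ edgeIdeal T e ∧ normalD T e u ∈ edgeIdeal T e ∧
      normalD T e (normalD T e u) ∈ edgeIdeal T e := by
  simp only [mem_edgeIdeal, ← forall_and]
  rfl

theorem airy_eq (u : Poly) : airy u =
    !![partialD 1 (partialD 1 u), -partialD 0 (partialD 1 u);
      -partialD 0 (partialD 1 u), partialD 0 (partialD 0 u)] := by
  ext1 i j
  fin_cases i <;> fin_cases j <;> simp [airy, curlComp, partialD_comm u 1 0]

theorem isSymm_airy (u : Poly) : (airy u).IsSymm := by
  rw [airy_eq]
  exact Matrix.IsSymm.ext fun i j => by fin_cases i <;> fin_cases j <;> rfl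

theorem forall_airy_mem_iff {V : Submodule ℝ Poly} :
    (∀ i j, airy u i j ∈ V) ↔ ∀ i j, partialD i (partialD j u) ∈ V := by
  simp only [airy_eq, Fin.forall_fin_two, Matrix.of_apply, Matrix.cons_val_zero,
    Matrix.cons_val_one, Matrix.cons_val_fin_one, neg_mem_iff, partialD_comm u 1 0]
  tauto

theorem airy_mem_bubbleSigma (hu : u ∈ bubbleU T (k + 2)) : airy u ∈ bubbleSigma T k := by
  obtain ⟨hdeg, hvert, hedge⟩ := mem_bubbleU.1 hu
  refine mem_bubbleSigma.2 ⟨isSymm_airy u, forall_airy_mem_iff.2 fun i j => ?_⟩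
  exact ⟨partialD_mem_polyDeg (partialD_mem_polyDeg hdeg j) i, (hvert.partialD j).partialD i,
    fun e => partialD_partialD_mem_edgeIdeal (hedge e).1 (hedge e).2.1 (hedge e).2.2 i j⟩

theorem eq_zero_of_airy_eq_zero (hu : VanishesAtVertices T 1 u) (h : airy u = 0) : u = 0 := by
  have hsecond : ∀ i j, partialD i (partialD j u) = 0 :=
    forall_airy_mem_iff (V := ⊥).1 (by simp [h])
  refine eq_zero_of_forall_partialD_eq_zero (fun j => ?_) (hu.val_eq_zero 0)
  exact eq_zero_of_forall_partialD_eq_zero (fun i => hsecond i j) ((hu.partialD j).val_eq_zero 0)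

theorem div_apply (σ : Matrix (Fin 2) (Fin 2) Poly) (i : Fin 2) :
    div σ i = ∑ j, partialD j (σ i j) := rfl

theorem div_airy (u : Poly) : div (airy u) = 0 := by
  ext1 i
  rw [div_apply, airy_eq]
  fin_cases i <;> simp [partialD_comm _ 1 0, Fin.sum_univ_two]

theorem exists_airy_eq_of_div_eq_zero (hdeg : ∀ i j, σ i j ∈ polyDeg k) (hsymm : σ.IsSymm)
    (hdiv : div σ = 0) (x : Plane) : ∃ u ∈ polyDeg (k + 2),
      airy u = σ ∧ val u x = 0 ∧ ∀ i, val (partialD i u) x = 0 := by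
  have hσ : σ 1 0 = σ 0 1 := hsymm.apply 0 1
  have hdiv0 : partialD 0 (σ 0 0) + partialD 1 (σ 0 1) = 0 := by
    simpa [div_apply] using congr_fun hdiv 0
  have hdiv1 : partialD 0 (σ 0 1) + partialD 1 (σ 1 1) = 0 := by
    simpa [div_apply, hσ] using congr_fun hdiv 1
  obtain ⟨a, ha, hax, ha0, ha1⟩ := exists_potential (neg_mem (hdeg 0 1)) (hdeg 0 0)
    (by rw [map_neg]; linear_combination -hdiv0) x
  obtain ⟨b, hb, hbx, hb0, hb1⟩ := exists_potential (hdeg 1 1) (neg_mem (hdeg 0 1))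
    (by rw [map_neg]; linear_combination hdiv1) x
  obtain ⟨u, hu, hux, rfl, rfl⟩ := exists_potential hb ha (by rw [hb1, ha0]) x
  refine ⟨u, hu, ?_, hux, Fin.forall_fin_two.2 ⟨hbx, hax⟩⟩
  rw [airy_eq, ha0, ha1, hb0, neg_neg]
  ext1 i j
  fin_cases i <;> fin_cases j <;> simp [hσ]

theorem val_points_eq_zero_of_forall_mem_edgeIdeal (h : ∀ e, u ∈ edgeIdeal T e) (v : Fin 3) :
    val u (T.points v) = 0 :=
  sub_add_cancel v 1 ▸ mem_edgeIdeal.1 (h (v - 1)) _ (points_add_one_mem_edge T (v - 1))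

theorem dirD_mem_edgeIdeal_of_forall_partialD_mem {e : Fin 3}
    (h : ∀ i, partialD i u ∈ edgeIdeal T e) (w : Plane) : dirD w u ∈ edgeIdeal T e :=
  add_mem (smul_mem_edgeIdeal _ (h 0)) (smul_mem_edgeIdeal _ (h 1))

theorem mem_bubbleU_of_forall_partialD_partialD_mem (hdeg : u ∈ polyDeg d)
    (h0 : val u (T.points 0) = 0) (h1 : ∀ i, val (partialD i u) (T.points 0) = 0)
    (h2 : ∀ i j, partialD i (partialD j u) ∈ scalarBubble T k) : u ∈ bubbleU T d := by
  have hgrad (j : Fin 2) : ∀ e, partialD j u ∈ edgeIdeal T e :=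
    mem_edgeIdeal_of_forall_dirD_mem (fun e =>
      dirD_mem_edgeIdeal_of_forall_partialD_mem (fun i => (h2 i j).2.2 e) _) (h1 j)
  have hval : ∀ e, u ∈ edgeIdeal T e :=
    mem_edgeIdeal_of_forall_dirD_mem (fun e =>
      dirD_mem_edgeIdeal_of_forall_partialD_mem (fun i => hgrad i e) _) h0
  refine mem_bubbleU.2 ⟨hdeg, ?_, fun e => ⟨hval e, ?_, ?_⟩⟩
  · exact vanishesAtVertices_succ_iff.2 ⟨val_points_eq_zero_of_forall_mem_edgeIdeal hval, fun j =>
      vanishesAtVertices_succ_iff.2 ⟨val_points_eq_zero_of_forall_mem_edgeIdeal (hgrad j),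
        fun i => (h2 i j).2.1⟩⟩
  · exact dirD_mem_edgeIdeal_of_forall_partialD_mem (fun i => hgrad i e) (edgeNormal T e)
  · refine dirD_mem_edgeIdeal_of_forall_partialD_mem (fun i => ?_) (edgeNormal T e)
    rw [partialD_eq_dirD]
    change dirD _ (dirD (edgeNormal T e) u) ∈ _
    rw [dirD_comm, ← partialD_eq_dirD]
    exact dirD_mem_edgeIdeal_of_forall_partialD_mem
      (fun j => partialD_comm u i j ▸ (h2 i j).2.2 e) _

theorem exists_airy_eq (hσ : σ ∈ bubbleSigma T k) (hdiv : div σ = 0) :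
    ∃ u ∈ bubbleU T (k + 2), airy u = σ := by
  obtain ⟨hsymm, hentry⟩ := mem_bubbleSigma.1 hσ
  obtain ⟨u, hdeg, rfl, h0, h1⟩ :=
    exists_airy_eq_of_div_eq_zero (fun i j => (hentry i j).1) hsymm hdiv (T.points 0)
  exact ⟨u, mem_bubbleU_of_forall_partialD_partialD_mem hdeg h0 h1 (forall_airy_mem_iff.1 hentry),
    rfl⟩

theorem div_mem_bubbleQ (hσ : σ ∈ bubbleSigma T k) : div σ ∈ bubbleQ T (k - 1) := by
  have h := (mem_bubbleSigma.1 hσ).2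
  refine fun i => ⟨?_, ?_⟩ <;> rw [div_apply]
  · exact Submodule.sum_mem _ fun j _ => partialD_mem_polyDeg (h i j).1 j
  · exact .sum fun j _ => (h i j).2.1.partialD j

end Airy

/-! ### Barycentric coordinates -/

/-- The polynomial of degree at most one that represents an affine function on the plane. -/
def affinePoly (f : Plane →ᵃ[ℝ] ℝ) : Poly :=
  C (f 0) + ∑ j, C (f.linear (EuclideanSpace.single j 1)) * X j

@[simp]
theorem val_affinePoly (f : Plane →ᵃ[ℝ] ℝ) (x : Plane) : val (affinePoly f) x = f x := by
  conv_rhs => rw [f.decomp, ← (EuclideanSpace.basisFun (Fin 2) ℝ).sum_repr x]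
  simp [affinePoly, mul_comm, add_comm]

theorem partialD_affinePoly (f : Plane →ᵃ[ℝ] ℝ) (i : Fin 2) :
    partialD i (affinePoly f) = C (f.linear (EuclideanSpace.single i 1)) := by
  simp [affinePoly, partialD_mul, -Fin.sum_univ_two]

theorem affinePoly_mem_polyDeg (f : Plane →ᵃ[ℝ] ℝ) : affinePoly f ∈ polyDeg 1 :=
  add_mem (C_mem_polyDeg 1 _) <| Submodule.sum_mem _ fun j _ =>
    mul_mem_polyDeg (C_mem_polyDeg 0 _) (X_mem_polyDeg j)

theorem eq_of_forall_val_eq {p q : Poly} (h : ∀ x, val p x = val q x) : p = q :=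
  sub_eq_zero.1 (eq_zero_of_forall_val_eq_zero fun x => by rw [val_sub, h, sub_self])

/-- The vertices of a triangle as an affine basis of the plane. -/
def vertexBasis (T : Triangle) : AffineBasis (Fin 3) ℝ Plane :=
  ⟨T.points, T.independent, T.independent.affineSpan_eq_top_iff_card_eq_finrank_add_one.2 (by simp)⟩

/-- The barycentric coordinates of a triangle, indexed by its vertices. -/
def bary (T : Triangle) (e : Fin 3) : Poly := affinePoly ((vertexBasis T).coord e)

/-- The cubic bubble function, the product of the barycentric coordinates. -/
def cubicBubble (T : Triangle) : Poly := ∏ e, bary T e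

section Bary

variable (T : Triangle) (e : Fin 3)

theorem val_bary (x : Plane) : val (bary T e) x = (vertexBasis T).coord e x := val_affinePoly _ x

@[simp]
theorem val_bary_points (v : Fin 3) : val (bary T e) (T.points v) = if e = v then 1 else 0 :=
  (val_bary T e _).trans ((vertexBasis T).coord_apply e v)

theorem sum_bary : ∑ e, bary T e = 1 :=
  eq_of_forall_val_eq fun x => by simp [val_bary]

theorem sum_points_mul_bary (i : Fin 2) : ∑ e, C (T.points e i) * bary T e = X i :=
  eq_of_forall_val_eq fun x => by
    conv_rhs => rw [val_X, ← (vertexBasis T).linear_combination_coord_eq_self x]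
    simp [mul_comm, val_bary, show ∀ e, vertexBasis T e = T.points e from fun _ => rfl]

theorem bary_mem_edgeIdeal : bary T e ∈ edgeIdeal T e := by
  rw [mem_edgeIdeal, edge, segment_eq_image_lineMap]
  rintro _ ⟨s, -, rfl⟩
  have h1 := val_bary_points T e (e + 1)
  have h2 := val_bary_points T e (e + 2)
  rw [if_neg (by lia), val_bary] at h1 h2
  rw [val_bary, AffineMap.apply_lineMap, h1, h2, AffineMap.lineMap_same_apply]

theorem exists_X_eq (i : Fin 2) : ∃ q, X i =
    C (T.points (e + 1) i) + C (edgeVec T e i) * bary T (e + 2) + bary T e * q := by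
  have h1 : ∑ v, bary T (e + v) = 1 :=
    (Equiv.sum_comp (Equiv.addLeft e) (bary T)).trans (sum_bary T)
  have hX : ∑ v, C (T.points (e + v) i) * bary T (e + v) = X i :=
    (Equiv.sum_comp (Equiv.addLeft e) fun v => C (T.points v i) * bary T v).trans
      (sum_points_mul_bary T i)
  rw [Fin.sum_univ_three, add_zero] at h1 hX
  refine ⟨C (T.points e i) - C (T.points (e + 1) i), ?_⟩
  rw [edgeVec, PiLp.sub_apply, C_sub]
  linear_combination C (T.points (e + 1) i) * h1 - hX

theorem bary_dvd_iff {p : Poly} : bary T e ∣ p ↔ p ∈ edgeIdeal T e := by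
  refine ⟨fun h => (edgeIdeal T e).mem_of_dvd h (bary_mem_edgeIdeal T e), fun h => ?_⟩
  let I : Ideal Poly := Ideal.span {bary T e}
  have hmk : (Ideal.Quotient.mkₐ ℝ I).comp ((Polynomial.aeval (bary T (e + 2))).comp
      (lineRes (T.points (e + 1)) (edgeVec T e))) = Ideal.Quotient.mkₐ ℝ I := by
    refine MvPolynomial.algHom_ext fun i => (Ideal.Quotient.eq.2 ?_).symm
    obtain ⟨q, hq⟩ := exists_X_eq T e i
    rw [Ideal.mem_span_singleton]
    refine ⟨q, sub_eq_iff_eq_add'.2 ?_⟩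
    simpa [lineRes, ← C_eq_algebraMap] using hq
  rw [← Ideal.mem_span_singleton, ← Ideal.Quotient.eq_zero_iff_mem]
  refine (DFunLike.congr_fun hmk p).symm.trans ?_
  rw [AlgHom.comp_apply, AlgHom.comp_apply, (RingHom.mem_ker.1 h : lineRes _ _ p = 0), map_zero,
    map_zero]

theorem bary_ne_zero : bary T e ≠ 0 := fun h => by
  simpa [h] using val_bary_points T e e

theorem prime_bary : Prime (bary T e) := by
  have h : Ideal.span {bary T e} = edgeIdeal T e :=
    Ideal.ext fun p => Ideal.mem_span_singleton.trans (bary_dvd_iff T e)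
  rw [← Ideal.span_singleton_prime (bary_ne_zero T e), h]
  exact RingHom.ker_isPrime _

theorem isRelPrime_bary {e e' : Fin 3} (h : e ≠ e') : IsRelPrime (bary T e) (bary T e') := by
  refine (prime_bary T e).irreducible.isRelPrime_iff_not_dvd.2 fun ⟨q, hq⟩ => ?_
  simpa [h] using congr_arg (val · (T.points e')) hq

theorem exists_partialD_bary : ∃ i, ∃ c : ℝ, c ≠ 0 ∧ partialD i (bary T e) = C c := by
  by_contra! h
  have h0 (i : Fin 2) : partialD i (bary T e) = 0 := by
    rw [bary, partialD_affinePoly, C_eq_zero]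
    by_contra hc
    exact h i _ hc (partialD_affinePoly _ i)
  refine bary_ne_zero T e (eq_zero_of_forall_partialD_eq_zero h0 (x := T.points (e + 1)) ?_)
  rw [val_bary_points, if_neg (by lia)]

theorem totalDegree_bary : (bary T e).totalDegree = 1 := by
  refine le_antisymm (mem_polyDeg.1 (affinePoly_mem_polyDeg _)) (Nat.one_le_iff_ne_zero.2 ?_)
  intro h
  obtain ⟨i, c, hc, hi⟩ := exists_partialD_bary T e
  rw [totalDegree_eq_zero_iff_eq_C.1 h, partialD_C, eq_comm, C_eq_zero] at hi
  exact hc hi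

theorem bary_pow_add_two_dvd {u : Poly} {n : ℕ} (hu : bary T e ^ (n + 1) ∣ u)
    (h : ∀ i, bary T e ^ (n + 1) ∣ partialD i u) : bary T e ^ (n + 2) ∣ u := by
  obtain ⟨i, c, hc, hi⟩ := exists_partialD_bary T e
  obtain ⟨w, rfl⟩ := hu
  have hpow : partialD i (bary T e ^ (n + 1)) = C ((n + 1) * c) * bary T e ^ n := by
    simp [partialD_apply, ← hi, Derivation.leibniz_pow]
    ring
  have hdvd := h i
  rw [partialD_mul, hpow, dvd_add_left (dvd_mul_right _ _), pow_succ, mul_comm (C _), mul_assoc,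
    mul_dvd_mul_iff_left (pow_ne_zero n (bary_ne_zero T e))] at hdvd
  have hunit : IsUnit (C ((n + 1) * c) : Poly) :=
    (isUnit_iff_ne_zero.2 (mul_ne_zero n.cast_add_one_ne_zero hc)).map C
  exact pow_succ (bary T e) (n + 1) ▸ mul_dvd_mul_left _ (hunit.dvd_mul_left.1 hdvd)

theorem cubicBubble_pow_dvd {u : Poly} {n : ℕ} (h : ∀ e, bary T e ^ n ∣ u) :
    cubicBubble T ^ n ∣ u := by
  rw [cubicBubble, ← Finset.prod_pow]
  exact Finset.prod_dvd_of_isRelPrime (fun e _ e' _ he => (isRelPrime_bary T he).pow)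
    fun e _ => h e

theorem cubicBubble_ne_zero : cubicBubble T ≠ 0 :=
  Finset.prod_ne_zero_iff.2 fun e _ => bary_ne_zero T e

theorem cubicBubble_mem_edgeIdeal : cubicBubble T ∈ edgeIdeal T e :=
  (bary_dvd_iff T e).1 (Finset.dvd_prod_of_mem _ (Finset.mem_univ e))

theorem totalDegree_cubicBubble : (cubicBubble T).totalDegree = 3 := by
  simp only [cubicBubble, Fin.prod_univ_three]
  rw [totalDegree_mul_of_isDomain (mul_ne_zero (bary_ne_zero T 0) (bary_ne_zero T 1))
    (bary_ne_zero T 2), totalDegree_mul_of_isDomain (bary_ne_zero T 0) (bary_ne_zero T 1)]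
  simp only [totalDegree_bary]

theorem vanishesAtVertices_cubicBubble : VanishesAtVertices T 1 (cubicBubble T) := by
  refine vanishesAtVertices_succ_iff.2 ⟨fun v => ?_, fun i => vanishesAtVertices_zero_iff.2
    fun v => ?_⟩ <;>
  fin_cases v <;>
  simp [cubicBubble, Fin.prod_univ_three, partialD_mul]

theorem val_cubicBubble_nonneg {x : Plane} (hx : x ∈ region T) : 0 ≤ val (cubicBubble T) x := by
  rw [region, show T.points = vertexBasis T from rfl, AffineBasis.convexHull_eq_nonneg_coord] at hx
  rw [cubicBubble, val, map_prod]
  exact Finset.prod_nonneg fun e _ => (hx e).trans_eq (val_bary T e x).symm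

end Bary

/-! ### Integration over the triangle -/

theorem val_dirD_hasDerivAt (p : Poly) (x d : Plane) (t : ℝ) :
    HasDerivAt (fun s : ℝ => val p (x + s • d)) (val (dirD d p) (x + t • d)) t := by
  simp only [← eval_lineRes, ← derivative_lineRes]
  exact (lineRes x d p).hasDerivAt t

section Slices

variable {K : Set Plane} {p : Poly}

theorem exists_preimage_line_eq_Icc (hK : IsCompact K) (hconv : Convex ℝ K) {x d : Plane}
    (hd : d ≠ 0) (hne : ((fun t : ℝ => x + t • d) ⁻¹' K).Nonempty) :
    ∃ a b : ℝ, a ≤ b ∧ (fun t : ℝ => x + t • d) ⁻¹' K = Set.Icc a b := by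
  have hcompact : IsCompact ((fun t : ℝ => x + t • d) ⁻¹' K) :=
    ((Homeomorph.addLeft x).isClosedEmbedding.comp
      (isClosedEmbedding_smul_left hd)).isCompact_preimage hK
  have hconvex : Convex ℝ ((fun t : ℝ => x + t • d) ⁻¹' K) := by
    simpa [Set.preimage, AffineMap.lineMap_apply, add_comm x] using
      hconv.affine_preimage (AffineMap.lineMap x (x + d) : ℝ →ᵃ[ℝ] Plane)
  have hIcc := eq_Icc_of_connected_compact ⟨hne, hconvex.isPreconnected⟩ hcompact
  refine ⟨_, _, ?_, hIcc⟩
  exact Set.nonempty_Icc.1 (hIcc ▸ hne)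

theorem setIntegral_line_dirD_eq_zero (hK : IsCompact K) (hconv : Convex ℝ K)
    (hp : ∀ x ∈ frontier K, val p x = 0) (x : Plane) {d : Plane} (hd : d ≠ 0) :
    ∫ t in (fun t : ℝ => x + t • d) ⁻¹' K, val (dirD d p) (x + t • d) = 0 := by
  obtain hempty | hne := ((fun t : ℝ => x + t • d) ⁻¹' K).eq_empty_or_nonempty
  · rw [hempty, setIntegral_empty]
  obtain ⟨a, b, hab, hIcc⟩ := exists_preimage_line_eq_Icc hK hconv hd hne
  have hend : ∀ t ∈ ({a, b} : Set ℝ), val p (x + t • d) = 0 := fun t ht => by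
    rw [← frontier_Icc hab, ← hIcc] at ht
    have hcont : Continuous fun t : ℝ => x + t • d := by fun_prop
    exact hp _ (hcont.frontier_preimage_subset K ht)
  rw [hIcc, integral_Icc_eq_integral_Ioc, ← intervalIntegral.integral_of_le hab,
    intervalIntegral.integral_eq_sub_of_hasDerivAt (fun t _ => val_dirD_hasDerivAt p x d t),
    hend b (by simp), hend a (by simp), sub_zero]
  exact ((continuous_val _).comp (by fun_prop)).intervalIntegrable a b

theorem setIntegral_eq_zero_of_forall_line {n : ℕ} {K : Set (EuclideanSpace ℝ (Fin (n + 1)))}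
    {f : EuclideanSpace ℝ (Fin (n + 1)) → ℝ} (hK : MeasurableSet K) (hf : IntegrableOn f K)
    (i : Fin (n + 1)) (h : ∀ x, ∫ t in (fun t : ℝ => x + t • EuclideanSpace.single i 1) ⁻¹' K,
      f (x + t • EuclideanSpace.single i 1) = 0) :
    ∫ x in K, f x = 0 := by
  let φ := (MeasurableEquiv.piFinSuccAbove (fun _ => ℝ) i).symm.trans
    (MeasurableEquiv.toLp 2 (Fin (n + 1) → ℝ))
  have hφ : MeasurePreserving φ :=
    (PiLp.volume_preserving_toLp _).comp (volume_preserving_piFinSuccAbove (fun _ => ℝ) i).symm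
  have hline (t : ℝ) (y : Fin n → ℝ) : φ (t, y) = φ (0, y) + t • EuclideanSpace.single i 1 := by
    ext j
    change i.insertNth (α := fun _ => ℝ) t y j =
      i.insertNth (α := fun _ => ℝ) 0 y j + t * (EuclideanSpace.single i 1 : EuclideanSpace ℝ _) j
    obtain rfl | ⟨j, rfl⟩ := i.eq_self_or_eq_succAbove j <;> simp
  have hint : Integrable (fun z => K.indicator f (φ z)) (volume.prod volume) :=
    (hφ.integrable_comp_emb φ.measurableEmbedding).2 ((integrable_indicator_iff hK).2 hf)
  rw [← integral_indicator hK, ← hφ.integral_comp' (g := K.indicator f), Measure.volume_eq_prod,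
    integral_prod_symm _ hint]
  refine integral_eq_zero_of_ae (.of_forall fun y => ?_)
  have hy := h (φ (0, y))
  rw [← integral_indicator (hK.preimage (by fun_prop))] at hy
  exact (integral_congr_ae (.of_forall fun t => congr_arg (K.indicator f) (hline t y))).trans hy

theorem setIntegral_partialD_eq_zero_of_frontier (hK : IsCompact K) (hconv : Convex ℝ K)
    (hp : ∀ x ∈ frontier K, val p x = 0) (i : Fin 2) : ∫ x in K, val (partialD i p) x = 0 := by
  refine setIntegral_eq_zero_of_forall_line hK.measurableSet
    ((continuous_val _).continuousOn.integrableOn_compact hK) i fun x => ?_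
  rw [partialD_eq_dirD]
  exact setIntegral_line_dirD_eq_zero hK hconv hp x (by simp)

end Slices

section Region

variable {T : Triangle} {p : Poly}

theorem region_eq (T : Triangle) : region T = {x | ∀ e, 0 ≤ (vertexBasis T).coord e x} :=
  (vertexBasis T).convexHull_eq_nonneg_coord

theorem interior_region (T : Triangle) :
    interior (region T) = {x | ∀ e, 0 < (vertexBasis T).coord e x} :=
  (vertexBasis T).interior_convexHull

theorem mem_edge_of_coord_eq_zero {e : Fin 3} {x : Plane} (hx : x ∈ region T)
    (he : (vertexBasis T).coord e x = 0) : x ∈ edge T e := by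
  have hsum : ∑ v, (vertexBasis T).coord (e + v) x = 1 :=
    (Equiv.sum_comp (Equiv.addLeft e) fun v => (vertexBasis T).coord v x).trans
      ((vertexBasis T).sum_coord_apply_eq_one x)
  have hcomb : ∑ v, (vertexBasis T).coord (e + v) x • T.points (e + v) = x :=
    (Equiv.sum_comp (Equiv.addLeft e) fun v => (vertexBasis T).coord v x • T.points v).trans
      ((vertexBasis T).linear_combination_coord_eq_self x)
  rw [Fin.sum_univ_three, add_zero, he] at hsum hcomb
  rw [region_eq] at hx
  exact ⟨_, _, hx (e + 1), hx (e + 2), by rwa [zero_add] at hsum,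
    by rwa [zero_smul, zero_add] at hcomb⟩

theorem exists_mem_edge_of_mem_frontier {x : Plane} (hx : x ∈ frontier (region T)) :
    ∃ e, x ∈ edge T e := by
  rw [(isCompact_region T).isClosed.frontier_eq, interior_region] at hx
  obtain ⟨e, he⟩ := not_forall.1 hx.2
  have hnonneg := hx.1
  rw [region_eq] at hnonneg
  exact ⟨e, mem_edge_of_coord_eq_zero hx.1 (le_antisymm (not_lt.1 he) (hnonneg e))⟩

theorem setIntegral_partialD_eq_zero (hp : ∀ e, p ∈ edgeIdeal T e) (i : Fin 2) :
    ∫ x in region T, val (partialD i p) x = 0 :=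
  setIntegral_partialD_eq_zero_of_frontier (isCompact_region T) (convex_convexHull ℝ _)
    (fun x hx => let ⟨e, he⟩ := exists_mem_edge_of_mem_frontier hx
      mem_edgeIdeal.1 (hp e) x he) i

theorem integrableOn_val (p : Poly) (T : Triangle) : IntegrableOn (val p) (region T) :=
  (continuous_val p).continuousOn.integrableOn_compact (isCompact_region T)

theorem interior_region_nonempty (T : Triangle) : (interior (region T)).Nonempty :=
  interior_convexHull_nonempty_iff_affineSpan_eq_top.2 (vertexBasis T).tot

theorem analyticOnNhd_val (p : Poly) : AnalyticOnNhd ℝ (val p) Set.univ :=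
  AnalyticOnNhd.eval_continuousLinearMap' (𝕜 := ℝ) (E := Plane) (EuclideanSpace.proj (𝕜 := ℝ)) p

theorem eq_zero_of_setIntegral_eq_zero (hnonneg : ∀ x ∈ region T, 0 ≤ val p x)
    (hp : ∫ x in region T, val p x = 0) : p = 0 := by
  have hae : val p =ᵐ[volume.restrict (interior (region T))] 0 :=
    ae_restrict_of_ae_restrict_of_subset interior_subset
      ((setIntegral_eq_zero_iff_of_nonneg_ae (ae_restrict_of_forall_mem
        (isCompact_region T).measurableSet hnonneg) (integrableOn_val p T)).1 hp)
  have heq := Measure.eqOn_open_of_ae_eq hae isOpen_interior (continuous_val p).continuousOn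
    continuousOn_const
  obtain ⟨x, hx⟩ := interior_region_nonempty T
  have h := (analyticOnNhd_val p).eq_of_eventuallyEq (z₀ := x) analyticOnNhd_const
    (heq.eventuallyEq_of_mem (isOpen_interior.mem_nhds hx))
  exact eq_zero_of_forall_val_eq_zero (congr_fun h)

end Region

section RigidMotions

variable {T : Triangle} {k : ℕ} {r : Fin 2 → Poly} {σ : Matrix (Fin 2) (Fin 2) Poly}

theorem partialD_add_partialD_eq_zero (hr : r ∈ rigidMotions) (i j : Fin 2) :
    partialD j (r i) + partialD i (r j) = 0 := by
  induction hr using Submodule.span_induction with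
  | mem r hr =>
    rcases hr with rfl | rfl | rfl <;> fin_cases i <;> fin_cases j <;> simp [partialD_apply]
  | zero => simp
  | add r s _ _ hr hs => simp only [Pi.add_apply, map_add]; linear_combination hr + hs
  | smul c r _ hr => simp only [Pi.smul_apply, map_smul, ← smul_add, hr, smul_zero]

theorem sum_div_mul_eq (hσ : σ.IsSymm) (hr : r ∈ rigidMotions) :
    ∑ i, div σ i * r i = ∑ j, partialD j (∑ i, σ i j * r i) := by
  have h00 : partialD 0 (r 0) = 0 := self_eq_neg.1
    (eq_neg_of_add_eq_zero_left (partialD_add_partialD_eq_zero hr 0 0))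
  have h11 : partialD 1 (r 1) = 0 := self_eq_neg.1
    (eq_neg_of_add_eq_zero_left (partialD_add_partialD_eq_zero hr 1 1))
  have h01 := partialD_add_partialD_eq_zero hr 0 1
  simp only [div_apply, Fin.sum_univ_two, map_add, partialD_mul, hσ.apply 0 1]
  linear_combination -σ 0 1 * h01 - σ 0 0 * h00 - σ 1 1 * h11

theorem div_mem_rmPerp (hσ : σ ∈ bubbleSigma T k) : div σ ∈ rmPerp T := by
  obtain ⟨hsymm, hentry⟩ := mem_bubbleSigma.1 hσ
  intro r hr
  calc ∫ x in region T, ∑ i, val (div σ i) x * val (r i) x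
      = ∫ x in region T, ∑ j, val (partialD j (∑ i, σ i j * r i)) x := by
        simp only [← val_mul, ← val_sum, sum_div_mul_eq hsymm hr]
    _ = ∑ j, ∫ x in region T, val (partialD j (∑ i, σ i j * r i)) x :=
        integral_finsetSum _ fun j _ => integrableOn_val _ T
    _ = 0 := Finset.sum_eq_zero fun j _ => setIntegral_partialD_eq_zero
        (fun e => sum_mem fun i _ => (edgeIdeal T e).mul_mem_right _ ((hentry i j).2.2 e)) j

end RigidMotions

/-! ### Dimensions of the bubble spaces -/

theorem finrank_map_add_finrank_inf_ker {K V W : Type*} [DivisionRing K] [AddCommGroup V]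
    [Module K V] [AddCommGroup W] [Module K W] (f : V →ₗ[K] W) (p : Submodule K V)
    [FiniteDimensional K p] :
    Module.finrank K (p.map f) + Module.finrank K ↥(p ⊓ LinearMap.ker f) = Module.finrank K p := by
  rw [← LinearMap.finrank_range_add_finrank_ker (f.domRestrict p), LinearMap.range_domRestrict,
    LinearMap.ker_domRestrict, ← Submodule.map_comap_subtype, Submodule.finrank_map_subtype_eq]

theorem finrank_restrictTotalDegree {σ R : Type*} [Fintype σ] [CommRing R] [Nontrivial R] (d : ℕ) :
    Module.finrank R (restrictTotalDegree σ R d) = (Fintype.card σ + 1).multichoose d := by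
  classical
  have hset : {s : σ →₀ ℕ | (s.sum fun _ e => e) ≤ d} =
      ((Finset.range (d + 1)).biUnion fun n => Finset.univ.finsuppAntidiag n :
        Finset (σ →₀ ℕ)) := by
    ext s
    simp [Finsupp.sum_fintype, Finset.mem_finsuppAntidiag, Order.lt_add_one_iff]
  have hsum (d : ℕ) : ∑ n ∈ Finset.range (d + 1), (Fintype.card σ).multichoose n =
      (Fintype.card σ + 1).multichoose d := by
    induction d with
    | zero => simp
    | succ d ih => rw [Finset.sum_range_succ, ih, Nat.multichoose_succ_succ, add_comm]
  rw [restrictTotalDegree, Module.finrank_eq_nat_card_basis (basisRestrictSupport R _), hset,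
    Nat.card_coe_set_eq, Set.ncard_coe_finset, Finset.card_biUnion, ← hsum]
  · simp only [Finset.card_finsuppAntidiag_nat_eq_multichoose, Finset.card_univ]
  · exact fun m _ n _ hmn => Finset.disjoint_left.2 fun s hm hn =>
      hmn (by rw [← (Finset.mem_finsuppAntidiag.1 hm).1, (Finset.mem_finsuppAntidiag.1 hn).1])

theorem two_mul_finrank_polyDeg (d : ℕ) :
    2 * Module.finrank ℝ (polyDeg d) = (d + 1) * (d + 2) := by
  rw [finrank_restrictTotalDegree, Fintype.card_fin, Nat.multichoose_eq,
    show 2 + 1 + d - 1 = d + 2 by omega, ← Nat.choose_symm (Nat.le_add_right d 2),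
    Nat.add_sub_cancel_left, Nat.choose_two_right,
    Nat.mul_div_cancel' (Nat.even_mul_pred_self _).two_dvd, mul_comm]
  rfl

section BubbleU

variable {T : Triangle} {d : ℕ} {u : Poly}

theorem bary_sq_dvd {e : Fin 3} (hu : u ∈ edgeIdeal T e) (h : ∀ i, partialD i u ∈ edgeIdeal T e) :
    bary T e ^ 2 ∣ u :=
  bary_pow_add_two_dvd T e (n := 0) (by simpa using (bary_dvd_iff T e).2 hu)
    fun i => by simpa using (bary_dvd_iff T e).2 (h i)

theorem cubicBubble_pow_three_dvd (hu : u ∈ bubbleU T d) : cubicBubble T ^ 3 ∣ u := by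
  obtain ⟨-, hvert, hedge⟩ := mem_bubbleU.1 hu
  have hhess (i j e) : partialD i (partialD j u) ∈ edgeIdeal T e :=
    partialD_partialD_mem_edgeIdeal (hedge e).1 (hedge e).2.1 (hedge e).2.2 i j
  have hgrad (i) : ∀ e, partialD i u ∈ edgeIdeal T e :=
    mem_edgeIdeal_of_forall_dirD_mem (fun e =>
      dirD_mem_edgeIdeal_of_forall_partialD_mem (fun j => hhess j i e) _)
      ((hvert.partialD i).val_eq_zero 0)
  exact cubicBubble_pow_dvd T fun e =>
    bary_pow_add_two_dvd T e (n := 1) (bary_sq_dvd (hedge e).1 fun i => hgrad i e)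
      fun i => bary_sq_dvd (hgrad i e) fun j => hhess j i e

theorem totalDegree_cubicBubble_pow (T : Triangle) (n : ℕ) :
    (cubicBubble T ^ n).totalDegree = n * 3 := by
  induction n with
  | zero => simp
  | succ n ih =>
    rw [pow_succ, totalDegree_mul_of_isDomain (pow_ne_zero n (cubicBubble_ne_zero T))
      (cubicBubble_ne_zero T), ih, totalDegree_cubicBubble]
    ring

theorem bubbleU_eq_bot_of_lt (hd : d < 9) : bubbleU T d = ⊥ := by
  refine (Submodule.eq_bot_iff _).2 fun u hu => by_contra fun hne => ?_
  have := totalDegree_le_of_dvd_of_isDomain (cubicBubble_pow_three_dvd hu) hne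
  have := mem_polyDeg.1 hu.1
  rw [totalDegree_cubicBubble_pow] at *
  omega

theorem bubbleU_le_map_mul_cubicBubble_pow_three (T : Triangle) (n : ℕ) :
    bubbleU T (n + 9) ≤ (polyDeg n).map (LinearMap.mulLeft ℝ (cubicBubble T ^ 3)) := by
  intro u hu
  obtain ⟨w, rfl⟩ := cubicBubble_pow_three_dvd hu
  rcases eq_or_ne w 0 with rfl | hw
  · simp
  · refine ⟨w, mem_polyDeg.2 ?_, rfl⟩
    have := mem_polyDeg.1 hu.1
    rw [totalDegree_mul_of_isDomain (pow_ne_zero 3 (cubicBubble_ne_zero T)) hw,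
      totalDegree_cubicBubble_pow] at this
    omega

theorem two_mul_finrank_bubbleU_add_le (T : Triangle) (j : ℕ) :
    2 * Module.finrank ℝ (bubbleU T (j + 7)) + j ≤ j ^ 2 := by
  rcases lt_or_ge j 2 with hj | hj
  · rw [bubbleU_eq_bot_of_lt (by omega), finrank_bot]
    interval_cases j <;> simp
  · obtain ⟨n, rfl⟩ := Nat.exists_eq_add_of_le' hj
    have hle := (Submodule.finrank_mono (bubbleU_le_map_mul_cubicBubble_pow_three T n)).trans
      (Submodule.finrank_map_le _ _)
    linarith [two_mul_finrank_polyDeg n, show (n + 2) ^ 2 = (n + 1) * (n + 2) + (n + 2) by ring]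

end BubbleU

section BubbleSigma

variable {T : Triangle} {m : ℕ} {p : Poly}

instance finiteDimensional_scalarBubble (T : Triangle) (k : ℕ) :
    FiniteDimensional ℝ (scalarBubble T k) :=
  Submodule.finiteDimensional_of_le (S₂ := polyDeg k) fun _ hp => hp.1

/-- A symmetric matrix field in the bubble space is given by its three independent entries. -/
def bubbleSigmaEquiv (T : Triangle) (k : ℕ) : (Fin 3 → scalarBubble T k) ≃ₗ[ℝ] bubbleSigma T k where
  toFun τ := ⟨!![τ 0, τ 1; τ 1, τ 2], mem_bubbleSigma.2 ⟨Matrix.IsSymm.ext fun i j => by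
    fin_cases i <;> fin_cases j <;> rfl, fun i j => by fin_cases i <;> fin_cases j <;> simp⟩⟩
  map_add' τ τ' := by ext i j : 2; fin_cases i <;> fin_cases j <;> rfl
  map_smul' c τ := by ext i j : 2; fin_cases i <;> fin_cases j <;> rfl
  invFun σ := ![⟨σ.1 0 0, (mem_bubbleSigma.1 σ.2).2 0 0⟩, ⟨σ.1 0 1, (mem_bubbleSigma.1 σ.2).2 0 1⟩,
    ⟨σ.1 1 1, (mem_bubbleSigma.1 σ.2).2 1 1⟩]
  left_inv τ := by ext l : 1; fin_cases l <;> rfl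
  right_inv σ := by
    ext i j : 2
    fin_cases i <;> fin_cases j
    exacts [rfl, rfl, σ.2.1.apply 1 0, rfl]

instance finiteDimensional_bubbleSigma (T : Triangle) (k : ℕ) :
    FiniteDimensional ℝ (bubbleSigma T k) :=
  Module.Finite.equiv (bubbleSigmaEquiv T k)

theorem finrank_bubbleSigma (T : Triangle) (k : ℕ) :
    Module.finrank ℝ (bubbleSigma T k) = 3 * Module.finrank ℝ (scalarBubble T k) := by
  rw [← (bubbleSigmaEquiv T k).finrank_eq, Module.finrank_pi_fintype]
  simp

/-- The values of a polynomial at the vertices. -/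
def vertexValues (T : Triangle) : Poly →ₗ[ℝ] (Fin 3 → ℝ) where
  toFun p v := val p (T.points v)
  map_add' p q := by ext v; simp
  map_smul' c p := by ext v; simp

theorem cubicBubble_mul_mem_polyDeg (T : Triangle) (hp : p ∈ polyDeg m) :
    cubicBubble T * p ∈ polyDeg (m + 3) :=
  add_comm 3 m ▸ mul_mem_polyDeg (mem_polyDeg.2 (totalDegree_cubicBubble T).le) hp

theorem cubicBubble_mul_mem_scalarBubble (hp : p ∈ polyDeg m)
    (hv : p ∈ LinearMap.ker (vertexValues T)) : cubicBubble T * p ∈ scalarBubble T (m + 3) :=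
  ⟨cubicBubble_mul_mem_polyDeg T hp, (vanishesAtVertices_cubicBubble T).mul
    (vanishesAtVertices_zero_iff.2 (congr_fun hv)),
    fun e => Ideal.mul_mem_right _ _ (cubicBubble_mem_edgeIdeal T e)⟩

theorem finrank_polyDeg_le_finrank_scalarBubble_add (T : Triangle) (m : ℕ) :
    Module.finrank ℝ (polyDeg m) ≤ Module.finrank ℝ (scalarBubble T (m + 3)) + 3 := by
  have hmap : (polyDeg m ⊓ LinearMap.ker (vertexValues T)).map
      (LinearMap.mulLeft ℝ (cubicBubble T)) ≤ scalarBubble T (m + 3) :=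
    Submodule.map_le_iff_le_comap.2 fun p hp => cubicBubble_mul_mem_scalarBubble hp.1 hp.2
  have hinj := (Submodule.equivMapOfInjective (LinearMap.mulLeft ℝ (cubicBubble T))
    (mul_right_injective₀ (cubicBubble_ne_zero T))
    (polyDeg m ⊓ LinearMap.ker (vertexValues T))).finrank_eq
  have hle := Submodule.finrank_mono hmap
  have hvalues := Submodule.finrank_le ((polyDeg m).map (vertexValues T))
  have hsum := finrank_map_add_finrank_inf_ker (vertexValues T) (polyDeg m)
  rw [Module.finrank_fin_fun] at hvalues
  omega

end BubbleSigma

section BubbleQ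

variable {T : Triangle} {m d : ℕ} {p : Poly}

/-- The values and the two first derivatives of a polynomial at the vertices; the first index is
the differential operator `1`, `∂ / ∂x` or `∂ / ∂y`, the second one the vertex. -/
def vertexJets (T : Triangle) : Poly →ₗ[ℝ] Fin 3 → Fin 3 → ℝ :=
  LinearMap.pi (Fin.cons (vertexValues T) fun i => vertexValues T ∘ₗ partialD i)

theorem mem_ker_vertexJets : p ∈ LinearMap.ker (vertexJets T) ↔ VanishesAtVertices T 1 p := by
  rw [vanishesAtVertices_succ_iff (m := 0)]
  simp only [vanishesAtVertices_zero_iff, LinearMap.mem_ker, funext_iff,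
    Fin.forall_fin_succ (n := 2)]
  rfl

/-- The Hermite interpolant of the jet `t` at the vertex `v` and of the zero jets at the other two
vertices. Multiplying by `bary T v ^ 2` kills the latter; the last summand makes up for the gradient
of this factor at `v`. -/
def hermite (T : Triangle) (v : Fin 3) (t : Fin 3 → ℝ) : Poly :=
  bary T v ^ 2 * (C (t 0) + C (t 1) * (X 0 - C (T.points v 0)) +
    C (t 2) * (X 1 - C (T.points v 1)) + C (2 * t 0) * (1 - bary T v))

theorem hermite_mem_polyDeg (v : Fin 3) (t : Fin 3 → ℝ) : hermite T v t ∈ polyDeg 3 := by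
  have hbary : bary T v ∈ polyDeg 1 := mem_polyDeg.2 (totalDegree_bary T v).le
  have hC (c : ℝ) {q : Poly} (hq : q ∈ polyDeg 1) : C c * q ∈ polyDeg 1 := by
    simpa using mul_mem_polyDeg (C_mem_polyDeg 0 c) hq
  have hX (i : Fin 2) : X i - C (T.points v i) ∈ polyDeg 1 :=
    sub_mem (X_mem_polyDeg i) (C_mem_polyDeg 1 _)
  exact mul_mem_polyDeg (pow_mem_polyDeg hbary 2) <|
    add_mem (add_mem (add_mem (C_mem_polyDeg 1 _) (hC _ (hX 0))) (hC _ (hX 1)))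
      (hC _ (sub_mem (C_mem_polyDeg 1 1) hbary))

theorem vertexJets_hermite (v : Fin 3) (t : Fin 3 → ℝ) :
    vertexJets T (hermite T v t) = fun i w => if v = w then t i else 0 := by
  ext i w
  cases i using Fin.cases with
  | zero =>
    change val (hermite T v t) (T.points w) = _
    rcases eq_or_ne v w with rfl | h <;> simp [hermite, *]
  | succ i =>
    change val (partialD i (hermite T v t)) (T.points w) = _
    rcases eq_or_ne v w with rfl | h
    · fin_cases i <;> simp [hermite, partialD_mul, pow_two] <;> ring
    · fin_cases i <;> simp [hermite, partialD_mul, pow_two, h]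

theorem map_vertexJets_polyDeg (T : Triangle) (hd : 3 ≤ d) :
    (polyDeg d).map (vertexJets T) = ⊤ := by
  refine eq_top_iff.2 fun t _ => ⟨∑ v, hermite T v fun i => t i v,
    sum_mem fun v _ => polyDeg_mono hd (hermite_mem_polyDeg v _), ?_⟩
  ext i w
  simp [vertexJets_hermite]

/-- A vector field in the bubble space is given by its two independent components. -/
def bubbleQEquiv (T : Triangle) (d : ℕ) :
    bubbleQ T d ≃ₗ[ℝ] (Fin 2 → ↥(polyDeg d ⊓ LinearMap.ker (vertexJets T))) where
  toFun q i := ⟨q.1 i, (q.2 i).1, mem_ker_vertexJets.2 (q.2 i).2⟩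
  map_add' _ _ := rfl
  map_smul' _ _ := rfl
  invFun q := ⟨fun i => q i, fun i => ⟨(q i).2.1, mem_ker_vertexJets.1 (q i).2.2⟩⟩

instance finiteDimensional_bubbleQ (T : Triangle) (d : ℕ) : FiniteDimensional ℝ (bubbleQ T d) :=
  Module.Finite.equiv (bubbleQEquiv T d).symm

theorem finrank_bubbleQ_add (T : Triangle) (hd : 3 ≤ d) :
    Module.finrank ℝ (bubbleQ T d) + 18 = 2 * Module.finrank ℝ (polyDeg d) := by
  have h := finrank_map_add_finrank_inf_ker (vertexJets T) (polyDeg d)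
  rw [map_vertexJets_polyDeg T hd, finrank_top] at h
  have hjet : Module.finrank ℝ (Fin 3 → Fin 3 → ℝ) = 9 := by simp [Module.finrank_pi_fintype]
  rw [(bubbleQEquiv T d).finrank_eq, Module.finrank_pi_fintype, Fin.sum_univ_two]
  omega

theorem eq_zero_of_cubicBubble_smul_mem_rmPerp {r : Fin 2 → Poly} (hr : r ∈ rigidMotions)
    (h : cubicBubble T • r ∈ rmPerp T) : r = 0 := by
  have hint : ∫ x in region T, val (cubicBubble T * ∑ i, r i ^ 2) x = 0 := by
    rw [← h r hr]
    simp only [val_mul, val_sum, Finset.mul_sum, pow_two, Pi.smul_apply, smul_eq_mul,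
      mul_assoc]
  have hmul := eq_zero_of_setIntegral_eq_zero (fun x hx => by
    simpa using mul_nonneg (val_cubicBubble_nonneg T hx) (by positivity)) hint
  have hsum := (mul_eq_zero.1 hmul).resolve_left (cubicBubble_ne_zero T)
  ext1 i
  refine eq_zero_of_forall_val_eq_zero fun x => ?_
  have hx : ∑ i, val (r i) x ^ 2 = 0 := by simpa using congr_arg (val · x) hsum
  simpa using (Finset.sum_eq_zero_iff_of_nonneg fun j _ => sq_nonneg (val (r j) x)).1 hx i

theorem finrank_bubbleQ_inf_rmPerp_add_card_le {ι : Type*} [Fintype ι] {b : ι → Fin 2 → Poly}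
    (hli : LinearIndependent ℝ b) (hb : ∀ l, b l ∈ rigidMotions)
    (hdeg : ∀ l i, b l i ∈ polyDeg m) :
    Module.finrank ℝ ↥(bubbleQ T (m + 3) ⊓ rmPerp T) + Fintype.card ι ≤
      Module.finrank ℝ (bubbleQ T (m + 3)) := by
  set V := Submodule.span ℝ (Set.range b)
  let μ := DistribSMul.toLinearMap ℝ (Fin 2 → Poly) (cubicBubble T)
  have hV : V ≤ rigidMotions := Submodule.span_le.2 (Set.range_subset_iff.2 hb)
  have hμ : Function.Injective μ := smul_right_injective _ (cubicBubble_ne_zero T)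
  have hle : V.map μ ≤ bubbleQ T (m + 3) := by
    rw [Submodule.map_span_le]
    rintro _ ⟨l, rfl⟩ i
    exact ⟨cubicBubble_mul_mem_polyDeg T (hdeg l i),
      (vanishesAtVertices_cubicBubble T).mul_right _⟩
  have hdisj : Disjoint (bubbleQ T (m + 3) ⊓ rmPerp T) (V.map μ) := by
    rw [Submodule.disjoint_def]
    rintro _ ⟨-, hperp⟩ ⟨r, hr, rfl⟩
    rw [eq_zero_of_cubicBubble_smul_mem_rmPerp (hV hr) hperp, map_zero]
  have hcard : Module.finrank ℝ (V.map μ) = Fintype.card ι := by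
    rw [← (Submodule.equivMapOfInjective μ hμ V).finrank_eq, finrank_span_eq_card hli]
  have hfin := Submodule.finiteDimensional_of_le hle
  rw [← hcard, ← Submodule.finrank_sup_add_finrank_inf_eq, hdisj.eq_bot, finrank_bot, add_zero]
  exact Submodule.finrank_mono (sup_le inf_le_left hle)

/-- The basis `(1, 0)`, `(0, 1)`, `(-y, x)` of the rigid motions. -/
def rmBasis : Fin 3 → Fin 2 → Poly := ![![1, 0], ![0, 1], ![-X 1, X 0]]

theorem rmBasis_mem_rigidMotions (l : Fin 3) : rmBasis l ∈ rigidMotions :=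
  Submodule.subset_span (by fin_cases l <;> simp [rmBasis])

theorem linearIndependent_rmBasis : LinearIndependent ℝ rmBasis := by
  rw [Fintype.linearIndependent_iff]
  intro c hc
  have hval (x : Plane) (i) : val ((∑ l, c l • rmBasis l) i) x = 0 := by rw [hc]; simp
  have h0 : c 0 = 0 := by simpa [rmBasis, Fin.sum_univ_three] using hval 0 0
  have h1 : c 1 = 0 := by simpa [rmBasis, Fin.sum_univ_three] using hval 0 1
  have h2 : c 2 = 0 := by simpa [rmBasis, Fin.sum_univ_three, h1] using hval !₂[1, 0] 1
  intro l
  fin_cases l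
  exacts [h0, h1, h2]

theorem rmBasis_mem_polyDeg (l : Fin 3) (i : Fin 2) : rmBasis l i ∈ polyDeg 1 := by
  fin_cases l <;> fin_cases i <;> simp [rmBasis, mem_polyDeg]

theorem bubbleQ_three_inf_rmPerp (T : Triangle) : bubbleQ T 3 ⊓ rmPerp T = ⊥ := by
  have hle : Module.finrank ℝ ↥(bubbleQ T 3 ⊓ rmPerp T) + _ ≤ Module.finrank ℝ (bubbleQ T 3) :=
    finrank_bubbleQ_inf_rmPerp_add_card_le (m := 0)
      (linearIndependent_rmBasis.comp _ (Fin.castSucc_injective 2))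
      (fun l => rmBasis_mem_rigidMotions _)
      fun l i => by fin_cases l <;> fin_cases i <;> simp [rmBasis, mem_polyDeg]
  have hQ := finrank_bubbleQ_add T le_rfl
  have hP := two_mul_finrank_polyDeg 3
  rw [Fintype.card_fin] at hle
  rw [← Submodule.finrank_eq_zero (R := ℝ)]
  omega

end BubbleQ

/-! ### Surjectivity of the divergence -/

theorem map_div_bubbleSigma (T : Triangle) (j : ℕ) :
    (bubbleSigma T (j + 5)).map div = bubbleQ T (j + 4) ⊓ rmPerp T := by
  have hle : (bubbleSigma T (j + 5)).map div ≤ bubbleQ T (j + 4) ⊓ rmPerp T := by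
    rintro _ ⟨σ, hσ, rfl⟩
    have h := div_mem_bubbleQ hσ
    rw [show j + 5 - 1 = j + 4 from rfl] at h
    exact ⟨h, div_mem_rmPerp hσ⟩
  refine Submodule.eq_of_le_of_finrank_le hle ?_
  have : FiniteDimensional ℝ (bubbleU T (j + 7)) :=
    Submodule.finiteDimensional_of_le (S₂ := polyDeg (j + 7)) fun u hu => hu.1
  have hker : bubbleSigma T (j + 5) ⊓ LinearMap.ker div ≤ (bubbleU T (j + 7)).map airy :=
    fun σ hσ => exists_airy_eq hσ.1 hσ.2
  have hU := (Submodule.finrank_mono hker).trans (Submodule.finrank_map_le _ _)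
  have hrank := finrank_map_add_finrank_inf_ker div (bubbleSigma T (j + 5))
  have hUcount := two_mul_finrank_bubbleU_add_le T j
  have hsigma : Module.finrank ℝ (bubbleSigma T (j + 5)) = _ := finrank_bubbleSigma T (j + 5)
  have hscalar : _ ≤ Module.finrank ℝ (scalarBubble T (j + 5)) + 3 :=
    finrank_polyDeg_le_finrank_scalarBubble_add T (j + 2)
  have hQ := finrank_bubbleQ_add (T := T) (d := j + 4) (by omega)
  have hperp : Module.finrank ℝ ↥(bubbleQ T (j + 4) ⊓ rmPerp T) + 3 ≤ _ :=
    finrank_bubbleQ_inf_rmPerp_add_card_le (m := j + 1) linearIndependent_rmBasis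
      rmBasis_mem_rigidMotions fun l i => polyDeg_mono (by omega) (rmBasis_mem_polyDeg l i)
  have hP₂ := two_mul_finrank_polyDeg (j + 2)
  have hP₄ := two_mul_finrank_polyDeg (j + 4)
  nlinarith

theorem exists_div_eq {T : Triangle} {k : ℕ} {q : Fin 2 → Poly}
    (hq : q ∈ bubbleQ T (k - 1) ⊓ rmPerp T) : ∃ σ ∈ bubbleSigma T k, div σ = q := by
  rcases le_or_gt k 4 with hk | hk
  · have hq' : q ∈ bubbleQ T 3 ⊓ rmPerp T :=
      ⟨fun i => ⟨polyDeg_mono (by omega) (hq.1 i).1, (hq.1 i).2⟩, hq.2⟩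
    rw [bubbleQ_three_inf_rmPerp, Submodule.mem_bot] at hq'
    exact ⟨0, zero_mem _, by rw [map_zero, hq']⟩
  · obtain ⟨j, rfl⟩ := Nat.exists_eq_add_of_le' hk
    rwa [show j + (4 + 1) - 1 = j + 4 by omega, ← map_div_bubbleSigma T j] at hq

theorem div_mem {T : Triangle} {k : ℕ} {σ : Matrix (Fin 2) (Fin 2) Poly}
    (hσ : σ ∈ bubbleSigma T k) : div σ ∈ bubbleQ T (k - 1) ⊓ rmPerp T :=
  ⟨div_mem_bubbleQ hσ, div_mem_rmPerp hσ⟩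

section BubbleSequence

variable {T : Triangle} {k : ℕ} (hU : ∀ u ∈ bubbleU T (k + 2), airy u ∈ bubbleSigma T k)
  (hS : ∀ σ ∈ bubbleSigma T k, div σ ∈ bubbleQ T (k - 1) ⊓ rmPerp T)

theorem injective_airy_restrict : Function.Injective (airy.restrict hU) := by
  rw [injective_iff_map_eq_zero]
  exact fun u hu => Subtype.ext <|
    eq_zero_of_airy_eq_zero (u.2.2.1.mono (by norm_num)) (congr_arg Subtype.val hu)

theorem exact_airy_restrict_div_restrict :
    Function.Exact (airy.restrict hU) (div.restrict hS) := by
  refine fun σ => ⟨fun h => ?_, ?_⟩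
  · obtain ⟨u, hu, h'⟩ := exists_airy_eq σ.2 (congr_arg Subtype.val h)
    exact ⟨⟨u, hu⟩, Subtype.ext h'⟩
  · rintro ⟨u, rfl⟩
    exact Subtype.ext (div_airy u)

theorem surjective_div_restrict : Function.Surjective (div.restrict hS) := fun q => by
  obtain ⟨σ, hσ, h⟩ := exists_div_eq q.2
  exact ⟨⟨σ, hσ⟩, Subtype.ext h⟩

end BubbleSequence

/-! ### Affine changes of variables -/

theorem totalDegree_aeval_le {σ τ R : Type*} [CommSemiring R] {f : σ → MvPolynomial τ R}
    (hf : ∀ i, (f i).totalDegree ≤ 1) (p : MvPolynomial σ R) :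
    (aeval f p).totalDegree ≤ p.totalDegree := by
  rw [aeval_def, eval₂_eq]
  refine totalDegree_finsetSum_le fun s hs => ?_
  calc (algebraMap R (MvPolynomial τ R) (p.coeff s) * ∏ i ∈ s.support, f i ^ s i).totalDegree
      ≤ 0 + ∑ i ∈ s.support, (f i ^ s i).totalDegree :=
        (totalDegree_mul _ _).trans <|
          add_le_add (totalDegree_C _).le (totalDegree_finsetProd _ _)
    _ ≤ ∑ i ∈ s.support, s i := by
        rw [zero_add]
        exact Finset.sum_le_sum fun i _ =>
          (totalDegree_pow _ _).trans (mul_le_of_le_one_right' (hf i))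
    _ ≤ p.totalDegree := le_totalDegree hs

/-- Composition of polynomials with an affine map. -/
def pull (F : Plane →ᵃ[ℝ] Plane) : Poly →ₐ[ℝ] Poly :=
  aeval fun i => affinePoly ((EuclideanSpace.proj (𝕜 := ℝ) i).toAffineMap.comp F)

/-- The Jacobian matrix of an affine map. -/
def jac (F : Plane →ᵃ[ℝ] Plane) : Matrix (Fin 2) (Fin 2) ℝ :=
  LinearMap.toMatrixOrthonormal (EuclideanSpace.basisFun (Fin 2) ℝ) F.linear

section Pull

variable (F : Plane →ᵃ[ℝ] Plane)

theorem jac_apply (i j : Fin 2) : jac F i j = F.linear (EuclideanSpace.single j 1) i := by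
  simp [jac, LinearMap.toMatrixOrthonormal_apply_apply, EuclideanSpace.inner_single_left]

theorem jac_comp (G : Plane →ᵃ[ℝ] Plane) : jac (F.comp G) = jac F * jac G :=
  map_mul (LinearMap.toMatrixOrthonormal (EuclideanSpace.basisFun (Fin 2) ℝ)) F.linear G.linear

@[simp]
theorem val_pull (p : Poly) (x : Plane) : val (pull F p) x = val p (F x) := by
  simp only [val, ← aeval_eq_eval, pull, comp_aeval_apply]
  congr 2
  funext i
  exact val_affinePoly _ x

theorem pull_pull (G : Plane →ᵃ[ℝ] Plane) (p : Poly) : pull F (pull G p) = pull (G.comp F) p :=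
  eq_of_forall_val_eq fun x => by simp only [val_pull, AffineMap.comp_apply]

theorem pull_id (p : Poly) : pull (AffineMap.id ℝ Plane) p = p :=
  eq_of_forall_val_eq fun x => by simp only [val_pull, AffineMap.id_apply]

theorem partialD_pull (j : Fin 2) (p : Poly) :
    partialD j (pull F p) = ∑ i, jac F i j • pull F (partialD i p) := by
  refine (derivation_aeval (pderiv j) _ p).trans (Finset.sum_congr rfl fun i _ => ?_)
  have hj := partialD_affinePoly ((EuclideanSpace.proj (𝕜 := ℝ) i).toAffineMap.comp F) j
  rw [partialD_apply] at hj
  rw [hj, mul_comm, ← smul_eq_C_mul, jac_apply]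
  rfl

theorem pull_mem_polyDeg {d : ℕ} {p : Poly} (hp : p ∈ polyDeg d) : pull F p ∈ polyDeg d :=
  mem_polyDeg.2 <|
    (totalDegree_aeval_le (fun _ => mem_polyDeg.1 (affinePoly_mem_polyDeg _)) p).trans
    (mem_polyDeg.1 hp)

variable {F} {S T : Triangle} (hF : ∀ v, F (S.points v) = T.points v)

include hF

theorem VanishesAtVertices.pull {m : ℕ} {p : Poly} (hp : VanishesAtVertices T m p) :
    VanishesAtVertices S m (pull F p) := by
  induction m generalizing p with
  | zero => exact vanishesAtVertices_zero_iff.2 fun v => by rw [val_pull, hF, hp.val_eq_zero]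
  | succ m ih =>
    refine vanishesAtVertices_succ_iff.2
      ⟨fun v => by rw [val_pull, hF, hp.val_eq_zero], fun j => ?_⟩
    rw [partialD_pull]
    exact .sum fun i _ => (ih (hp.partialD i)).smul _

theorem pull_mem_edgeIdeal {e : Fin 3} {p : Poly} (hp : p ∈ edgeIdeal T e) :
    pull F p ∈ edgeIdeal S e := by
  refine mem_edgeIdeal.2 fun x hx => ?_
  rw [val_pull]
  refine mem_edgeIdeal.1 hp _ ?_
  rw [edge, ← hF, ← hF, ← image_segment]
  exact Set.mem_image_of_mem _ hx

theorem pull_mem_scalarBubble {k : ℕ} {p : Poly} (hp : p ∈ scalarBubble T k) :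
    pull F p ∈ scalarBubble S k :=
  ⟨pull_mem_polyDeg F hp.1, hp.2.1.pull hF, fun e => pull_mem_edgeIdeal hF (hp.2.2 e)⟩

theorem image_region : F '' region S = region T := by
  rw [region, region, AffineMap.image_convexHull, ← Set.range_comp]
  congr 2
  exact funext hF

end Pull

theorem exists_affineEquiv_forall_points_eq (S T : Triangle) :
    ∃ F : Plane ≃ᵃ[ℝ] Plane, ∀ v, F (S.points v) = T.points v := by
  let L : Plane ≃ₗ[ℝ] Plane :=
    ((vertexBasis S).basisOf 0).equiv ((vertexBasis T).basisOf 0) (Equiv.refl _)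
  refine ⟨(AffineEquiv.vaddConst ℝ (S.points 0)).symm.trans
    (L.toAffineEquiv.trans (AffineEquiv.vaddConst ℝ (T.points 0))), fun v => ?_⟩
  rcases eq_or_ne v 0 with rfl | hv
  · simp
  · have hL : L (S.points v - S.points 0) = T.points v - T.points 0 := by
      have hbasis := ((vertexBasis S).basisOf 0).equiv_apply ⟨v, hv⟩
        ((vertexBasis T).basisOf 0) (Equiv.refl _)
      rwa [AffineBasis.basisOf_apply, Equiv.refl_apply, AffineBasis.basisOf_apply] at hbasis
    simp [hL]

theorem setIntegral_region_eq {F : Plane ≃ᵃ[ℝ] Plane} {S T : Triangle}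
    (hF : ∀ v, F (S.points v) = T.points v) (f : Plane → ℝ) :
    ∫ x in region T, f x = |F.linear.toLinearMap.det| * ∫ x in region S, f (F x) := by
  have hderiv : ∀ x ∈ region S, HasFDerivWithinAt F F.linear.toLinearMap.toContinuousLinearMap
      (region S) x := fun x _ => by
    rw [← AffineEquiv.coe_toAffineMap, AffineMap.decomp]
    exact F.linear.toLinearMap.toContinuousLinearMap.hasFDerivWithinAt.add_const _
  rw [← image_region (F := F) hF, AffineEquiv.coe_toAffineMap,
    integral_image_eq_integral_abs_det_fderiv_smul volume (isCompact_region S).measurableSet hderiv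
      F.injective.injOn, integral_smul]
  rfl

/-! ### The Piola transforms -/

section Piola

/-- The Piola transform of vector fields along an affine isomorphism `F`: the field `q` becomes
`(DF) q ∘ F⁻¹`. -/
def piolaVec (F : Plane ≃ᵃ[ℝ] Plane) : (Fin 2 → Poly) →ₗ[ℝ] (Fin 2 → Poly) where
  toFun q i := ∑ a, jac F i a • pull F.symm (q a)
  map_add' p q := by ext1 i; simp [Finset.sum_add_distrib, -Fin.sum_univ_two]
  map_smul' c q := by ext1 i; simp [Finset.smul_sum, smul_comm c, -Fin.sum_univ_two]

/-- The Piola transform of matrix fields along an affine isomorphism `F`: the field `σ` becomes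
`(DF) (σ ∘ F⁻¹) (DF)ᵀ`. The determinant factor of the usual convention is omitted. -/
def piolaMat (F : Plane ≃ᵃ[ℝ] Plane) :
    Matrix (Fin 2) (Fin 2) Poly →ₗ[ℝ] Matrix (Fin 2) (Fin 2) Poly where
  toFun σ := Matrix.of fun i j => ∑ z : Fin 2 × Fin 2,
    (jac F i z.1 * jac F j z.2) • pull F.symm (σ z.1 z.2)
  map_add' σ τ := by ext1 i j; simp [Finset.sum_add_distrib, -Fin.sum_univ_two]
  map_smul' c σ := by ext1 i j; simp [Finset.smul_sum, smul_comm c, -Fin.sum_univ_two]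

variable (F : Plane ≃ᵃ[ℝ] Plane)

theorem piolaVec_apply (q : Fin 2 → Poly) (i : Fin 2) :
    piolaVec F q i = ∑ a, jac F i a • pull F.symm (q a) := rfl

theorem piolaMat_apply (σ : Matrix (Fin 2) (Fin 2) Poly) (i j : Fin 2) :
    piolaMat F σ i j =
      ∑ z : Fin 2 × Fin 2, (jac F i z.1 * jac F j z.2) • pull F.symm (σ z.1 z.2) := rfl

theorem comp_symm_eq_id : (F : Plane →ᵃ[ℝ] Plane).comp F.symm = AffineMap.id ℝ Plane :=
  AffineMap.ext F.apply_symm_apply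

theorem jac_mul_jac_symm : jac F * jac F.symm = 1 := by
  rw [← jac_comp, comp_symm_eq_id]
  exact map_one _

theorem jac_symm_mul_jac : jac F.symm * jac F = 1 := mul_eq_one_comm.1 (jac_mul_jac_symm F)

theorem piolaVec_symm (q : Fin 2 → Poly) : piolaVec F (piolaVec F.symm q) = q := by
  ext1 i
  calc piolaVec F (piolaVec F.symm q) i
      = ∑ b, (jac F * jac F.symm) i b • pull F.symm (pull F (q b)) := by
        simp only [piolaVec_apply, map_sum, map_smul, Finset.smul_sum, smul_smul,
          Matrix.mul_apply, Finset.sum_smul]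
        exact Finset.sum_comm
    _ = ∑ b, (1 : Matrix (Fin 2) (Fin 2) ℝ) i b • q b := by
        rw [jac_mul_jac_symm]
        refine Finset.sum_congr rfl fun b _ => ?_
        rw [pull_pull, comp_symm_eq_id, pull_id]
    _ = q i := by simp [Matrix.one_apply]

theorem div_piolaMat (σ : Matrix (Fin 2) (Fin 2) Poly) :
    div (piolaMat F σ) = piolaVec F (div σ) := by
  ext1 i
  calc div (piolaMat F σ) i = ∑ a, ∑ b, ∑ c, (jac F i a * (jac F.symm * jac F) c b) •
        pull F.symm (partialD c (σ a b)) := by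
        simp only [div_apply, piolaMat_apply, Fintype.sum_prod_type, map_sum, map_smul,
          partialD_pull]
        simp only [Matrix.mul_apply, Fin.sum_univ_two]
        module
    _ = piolaVec F (div σ) i := by
        simp [jac_symm_mul_jac, piolaVec_apply, div_apply, Matrix.one_apply, Finset.smul_sum,
          -Fin.sum_univ_two]

variable {F} {S T : Triangle} (hF : ∀ v, F (S.points v) = T.points v)

include hF

theorem piolaMat_mem_bubbleSigma {k : ℕ} {σ : Matrix (Fin 2) (Fin 2) Poly}
    (hσ : σ ∈ bubbleSigma S k) : piolaMat F σ ∈ bubbleSigma T k := by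
  have hF' (v : Fin 3) : (F.symm : Plane →ᵃ[ℝ] Plane) (T.points v) = S.points v :=
    F.symm_apply_eq.2 (hF v).symm
  obtain ⟨hsymm, hσ⟩ := mem_bubbleSigma.1 hσ
  refine mem_bubbleSigma.2 ⟨Matrix.IsSymm.ext fun i j => ?_, fun i j => ?_⟩
  · simp only [piolaMat_apply, Fintype.sum_prod_type]
    rw [Finset.sum_comm]
    simp only [hsymm.apply, mul_comm]
  · rw [piolaMat_apply]
    exact sum_mem fun z _ => Submodule.smul_mem _ _ (pull_mem_scalarBubble hF' (hσ z.1 z.2))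

theorem piolaVec_mem {k : ℕ} {q : Fin 2 → Poly}
    (hq : q ∈ bubbleQ S (k - 1) ⊓ rmPerp S) : piolaVec F q ∈ bubbleQ T (k - 1) ⊓ rmPerp T := by
  obtain ⟨σ, hσ, rfl⟩ := exists_div_eq hq
  rw [← div_piolaMat]
  exact div_mem (piolaMat_mem_bubbleSigma hF hσ)

end Piola

/-! ### The squared `L²` norm -/

theorem exists_forall_le_mul_inner {V : Type*} [NormedAddCommGroup V] [InnerProductSpace ℝ V]
    [FiniteDimensional ℝ V] (A : V →ₗ[ℝ] V →ₗ[ℝ] ℝ) :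
    ∃ C, 0 ≤ C ∧ ∀ x, A x x ≤ C * inner ℝ x x := by
  refine ⟨‖A.toContinuousBilinearMap‖, ContinuousLinearMap.opNorm_nonneg _, fun x => ?_⟩
  rw [real_inner_self_eq_norm_sq, pow_two, ← mul_assoc]
  exact (le_abs_self _).trans (A.toContinuousBilinearMap.le_opNorm₂ x x)

theorem exists_forall_le_mul_of_posDef {V : Type*} [AddCommGroup V] [Module ℝ V]
    [FiniteDimensional ℝ V] (A B : V →ₗ[ℝ] V →ₗ[ℝ] ℝ) (hsymm : ∀ x y, B x y = B y x)
    (hnonneg : ∀ x, 0 ≤ B x x) (hdef : ∀ x, B x x = 0 → x = 0) :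
    ∃ C, 0 ≤ C ∧ ∀ x, A x x ≤ C * B x x := by
  let core : InnerProductSpace.Core ℝ V :=
    { inner := fun x y => B x y
      conj_inner_symm := fun x y => hsymm y x
      re_inner_nonneg := hnonneg
      add_left := fun x y z => by simp
      smul_left := fun x y r => by simp
      definite := hdef }
  exact @exists_forall_le_mul_inner V core.toNormedAddCommGroup (.ofCore core.toCore) _ A

theorem sq_sum_mul_le {ι : Type*} [Fintype ι] (w z : ι → ℝ) {K : ℝ} (h : ∀ i, |w i| ≤ K) :
    (∑ i, w i * z i) ^ 2 ≤ Fintype.card ι * K ^ 2 * ∑ i, z i ^ 2 := by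
  calc (∑ i, w i * z i) ^ 2 ≤ (∑ i, w i ^ 2) * ∑ i, z i ^ 2 := Finset.sum_mul_sq_le_sq_mul_sq _ _ _
    _ ≤ (∑ _i : ι, K ^ 2) * ∑ i, z i ^ 2 := by
        refine mul_le_mul_of_nonneg_right (Finset.sum_le_sum fun i _ => ?_) (by positivity)
        exact sq_le_sq' (abs_le.1 (h i)).1 (abs_le.1 (h i)).2
    _ = Fintype.card ι * K ^ 2 * ∑ i, z i ^ 2 := by simp

section L2NormSq

variable {ι κ : Type*} [Fintype ι] [Fintype κ]

/-- The square of the `L²(T)` norm of a finite family of polynomials, such as the components of a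
tensor field. -/
def l2NormSq (T : Triangle) (f : ι → Poly) : ℝ := ∫ x in region T, ∑ i, val (f i) x ^ 2

/-- The `L²(T)` inner product of finite families of polynomials, as a bilinear form. -/
def l2Form (T : Triangle) : (ι → Poly) →ₗ[ℝ] (ι → Poly) →ₗ[ℝ] ℝ :=
  ∑ i, ((LinearMap.mul ℝ Poly).compl₁₂ (LinearMap.proj i) (LinearMap.proj i)).compr₂
    { toFun := fun p => ∫ x in region T, val p x
      map_add' := fun p q => by
        simp only [val_add]
        exact integral_add (integrableOn_val p T) (integrableOn_val q T)
      map_smul' := fun c p => by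
        simp only [val_smul]
        exact integral_const_mul _ _ }

theorem l2Form_apply (T : Triangle) (f g : ι → Poly) :
    l2Form T f g = ∑ i, ∫ x in region T, val (f i * g i) x := by
  simp [l2Form]

theorem integrableOn_sum_sq (T : Triangle) (f : ι → Poly) :
    IntegrableOn (fun x => ∑ i, val (f i) x ^ 2) (region T) := by
  have h : IntegrableOn (fun x => val (∑ i, f i ^ 2) x) (region T) := integrableOn_val _ T
  simpa only [val_sum, val_pow] using h

variable {T : Triangle}

theorem l2Form_self (f : ι → Poly) : l2Form T f f = l2NormSq T f := by
  rw [l2Form_apply, ← integral_finsetSum _ fun i _ => integrableOn_val _ T]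
  simp only [val_mul, l2NormSq, pow_two]

theorem l2NormSq_nonneg (f : ι → Poly) : 0 ≤ l2NormSq T f :=
  integral_nonneg fun _ => Finset.sum_nonneg fun _ _ => sq_nonneg _

theorem eq_zero_of_l2NormSq_eq_zero {f : ι → Poly} (h : l2NormSq T f = 0) : f = 0 := by
  have hsum : ∑ i, f i ^ 2 = 0 := by
    refine eq_zero_of_setIntegral_eq_zero (T := T) (fun x _ => ?_) ?_
    · simp only [val_sum, val_pow]
      positivity
    · simp only [val_sum, val_pow]
      exact h
  refine funext fun i => eq_zero_of_forall_val_eq_zero fun x => ?_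
  have hx : ∑ i, val (f i) x ^ 2 = 0 := by simpa using congr_arg (val · x) hsum
  exact pow_eq_zero_iff two_ne_zero |>.1 <|
    (Finset.sum_eq_zero_iff_of_nonneg fun _ _ => sq_nonneg _).1 hx i (Finset.mem_univ i)

theorem exists_l2NormSq_le_mul {V : Type*} [AddCommGroup V] [Module ℝ V] [FiniteDimensional ℝ V]
    (L : V →ₗ[ℝ] ι → Poly) {M : V →ₗ[ℝ] κ → Poly} (hM : Function.Injective M) :
    ∃ C, 0 ≤ C ∧ ∀ x, l2NormSq T (L x) ≤ C * l2NormSq T (M x) := by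
  obtain ⟨C, hC, h⟩ := exists_forall_le_mul_of_posDef
    ((l2Form T).compl₁₂ L L) ((l2Form T).compl₁₂ M M)
    (fun x y => by simp only [LinearMap.compl₁₂_apply, l2Form_apply, mul_comm])
    (fun x => by simpa only [LinearMap.compl₁₂_apply, l2Form_self] using l2NormSq_nonneg _)
    (fun x hx => by
      rw [LinearMap.compl₁₂_apply, l2Form_self] at hx
      exact hM ((eq_zero_of_l2NormSq_eq_zero hx).trans (map_zero M).symm))
  exact ⟨C, hC, fun x => by simpa only [LinearMap.compl₁₂_apply, l2Form_self] using h x⟩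

theorem l2NormSq_sum_smul_le {W : ι → κ → ℝ} {K : ℝ} (hW : ∀ i j, |W i j| ≤ K) (f : κ → Poly) :
    l2NormSq T (fun i => ∑ j, W i j • f j) ≤
      Fintype.card ι * (Fintype.card κ * K ^ 2) * l2NormSq T f := by
  rw [l2NormSq, l2NormSq, ← integral_const_mul]
  refine setIntegral_mono (integrableOn_sum_sq T _) ((integrableOn_sum_sq T f).const_mul _)
    fun x => ?_
  calc ∑ i, val (∑ j, W i j • f j) x ^ 2
      ≤ ∑ _i : ι, Fintype.card κ * K ^ 2 * ∑ j, val (f j) x ^ 2 := by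
        refine Finset.sum_le_sum fun i _ => ?_
        simpa only [val_sum, val_smul] using sq_sum_mul_le (W i) (fun j => val (f j) x) (hW i)
    _ = Fintype.card ι * (Fintype.card κ * K ^ 2) * ∑ j, val (f j) x ^ 2 := by
        simp [mul_assoc]

variable {F : Plane ≃ᵃ[ℝ] Plane} {S : Triangle} (hF : ∀ v, F (S.points v) = T.points v)

include hF

theorem l2NormSq_eq_det_mul (f : ι → Poly) :
    l2NormSq T f = |F.linear.toLinearMap.det| * l2NormSq S fun i => pull F (f i) := by
  rw [l2NormSq, setIntegral_region_eq hF]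
  simp only [l2NormSq, val_pull, AffineEquiv.coe_toAffineMap]

theorem l2NormSq_pull_symm (f : ι → Poly) :
    (l2NormSq T fun i => pull F.symm (f i)) = |F.linear.toLinearMap.det| * l2NormSq S f := by
  rw [l2NormSq_eq_det_mul hF]
  simp only [l2NormSq, val_pull, AffineEquiv.coe_toAffineMap, AffineEquiv.symm_apply_apply]

end L2NormSq

/-- The components of a matrix field. -/
def entries : Matrix (Fin 2) (Fin 2) Poly →ₗ[ℝ] (Fin 2 × Fin 2 → Poly) :=
  LinearMap.pi fun z => Matrix.entryLinearMap ℝ Poly z.1 z.2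

/-- The components of the gradient of a matrix field; the last index is that of the derivative. -/
def grad : Matrix (Fin 2) (Fin 2) Poly →ₗ[ℝ] (Fin 2 × Fin 2 × Fin 2 → Poly) :=
  LinearMap.pi fun z => partialD z.2.2 ∘ₗ Matrix.entryLinearMap ℝ Poly z.1 z.2.1

theorem l2Norm_eq (T : Triangle) (q : Fin 2 → Poly) : l2Norm T q = √(l2NormSq T q) := rfl

theorem h1Seminorm_eq (T : Triangle) (σ : Matrix (Fin 2) (Fin 2) Poly) :
    h1Seminorm T σ = √(l2NormSq T (grad σ)) := by
  simp only [h1Seminorm, l2NormSq, Fintype.sum_prod_type]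
  rfl

theorem h1Norm_eq (T : Triangle) (σ : Matrix (Fin 2) (Fin 2) Poly) :
    h1Norm T σ = √(l2NormSq T (entries σ) + l2NormSq T (grad σ)) := by
  rw [h1Norm, h1Seminorm_eq, Real.sq_sqrt (l2NormSq_nonneg _)]
  simp only [l2NormSq, Fintype.sum_prod_type]
  rfl

/-! ### Scaling of the Piola transforms -/

section Scaling

theorem abs_jac_le {F : Plane →ᵃ[ℝ] Plane} {A B : Set Plane} (hF : Set.MapsTo F A B)
    (hB : Bornology.IsBounded B) {c : Plane} {r : ℝ} (hr : 0 < r)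
    (hball : Metric.closedBall c r ⊆ A) (i j : Fin 2) :
    |jac F i j| ≤ Metric.diam B / (2 * r) := by
  have hmem (t : ℝ) (ht : |t| = r) : F (c + t • EuclideanSpace.single j 1) ∈ B :=
    hF (hball (by simp [norm_smul, ht]))
  have hdiff : F (c + r • EuclideanSpace.single j 1) - F (c + (-r) • EuclideanSpace.single j 1) =
      (2 * r) • F.linear (EuclideanSpace.single j 1) := by
    rw [← vsub_eq_sub, ← AffineMap.linearMap_vsub, ← map_smul]
    congr 1
    simp only [vsub_eq_sub]
    module
  rw [le_div_iff₀ (by positivity), jac_apply]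
  calc |F.linear (EuclideanSpace.single j 1) i| * (2 * r)
      = ‖((2 * r) • F.linear (EuclideanSpace.single j 1)) i‖ := by
        simp [abs_of_pos hr, mul_comm]
    _ ≤ ‖(2 * r) • F.linear (EuclideanSpace.single j 1)‖ := PiLp.norm_apply_le _ i
    _ ≤ Metric.diam B := by
        rw [← hdiff, ← dist_eq_norm]
        exact Metric.dist_le_diam_of_mem hB (hmem r (abs_of_pos hr))
          (hmem (-r) (by rw [abs_neg, abs_of_pos hr]))

variable {F : Plane ≃ᵃ[ℝ] Plane} {S T : Triangle} (hF : ∀ v, F (S.points v) = T.points v)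
  {μ ν : ℝ}

include hF

theorem l2NormSq_entries_piolaMat_le (hμ : ∀ i j, |jac F i j| ≤ μ)
    (σ : Matrix (Fin 2) (Fin 2) Poly) :
    l2NormSq T (entries (piolaMat F σ)) ≤
      16 * μ ^ 4 * (|F.linear.toLinearMap.det| * l2NormSq S (entries σ)) := by
  have hW (y z : Fin 2 × Fin 2) : |jac F y.1 z.1 * jac F y.2 z.2| ≤ μ ^ 2 := by
    rw [abs_mul, pow_two]
    exact mul_le_mul (hμ _ _) (hμ _ _) (abs_nonneg _) ((abs_nonneg _).trans (hμ 0 0))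
  have h := l2NormSq_sum_smul_le (T := T) hW fun z => pull F.symm (entries σ z)
  rw [l2NormSq_pull_symm hF] at h
  refine h.trans_eq ?_
  simp only [Fintype.card_prod, Fintype.card_fin]
  push_cast
  ring

theorem l2NormSq_grad_piolaMat_le (hμ : ∀ i j, |jac F i j| ≤ μ)
    (hν : ∀ i j, |jac F.symm i j| ≤ ν) (σ : Matrix (Fin 2) (Fin 2) Poly) :
    l2NormSq T (grad (piolaMat F σ)) ≤
      64 * μ ^ 4 * ν ^ 2 * (|F.linear.toLinearMap.det| * l2NormSq S (grad σ)) := by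
  let W (y z : Fin 2 × Fin 2 × Fin 2) : ℝ :=
    jac F y.1 z.1 * jac F y.2.1 z.2.1 * jac F.symm z.2.2 y.2.2
  have hμ0 : 0 ≤ μ := (abs_nonneg _).trans (hμ 0 0)
  have hW (y z) : |W y z| ≤ μ ^ 2 * ν := by
    rw [abs_mul, abs_mul, pow_two]
    exact mul_le_mul (mul_le_mul (hμ _ _) (hμ _ _) (abs_nonneg _) hμ0) (hν _ _) (abs_nonneg _)
      (mul_nonneg hμ0 hμ0)
  have hgrad : grad (piolaMat F σ) = fun y => ∑ z, W y z • pull F.symm (grad σ z) := by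
    ext1 y
    change partialD y.2.2 (∑ z : Fin 2 × Fin 2,
      (jac F y.1 z.1 * jac F y.2.1 z.2) • pull F.symm (σ z.1 z.2)) = _
    simp only [Fintype.sum_prod_type, map_sum, map_smul, partialD_pull, Finset.smul_sum, smul_smul]
    rfl
  have h := l2NormSq_sum_smul_le (T := T) hW fun z => pull F.symm (grad σ z)
  rw [← hgrad, l2NormSq_pull_symm hF] at h
  refine h.trans_eq ?_
  simp only [Fintype.card_prod, Fintype.card_fin]
  push_cast
  ring

theorem det_mul_l2NormSq_piolaVec_symm_le (hν : ∀ i j, |jac F.symm i j| ≤ ν) (q : Fin 2 → Poly) :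
    |F.linear.toLinearMap.det| * l2NormSq S (piolaVec F.symm q) ≤ 4 * ν ^ 2 * l2NormSq T q := by
  have h := l2NormSq_sum_smul_le (T := S) hν fun a => pull F (q a)
  rw [l2NormSq_eq_det_mul hF, mul_left_comm]
  refine mul_le_mul_of_nonneg_left (h.trans_eq ?_) (abs_nonneg _)
  simp only [Fintype.card_fin]
  push_cast
  ring

end Scaling

/-! ### Bounded right inverses of the divergence -/

/-- The divergence of the bubble spaces on `T` has a linear right inverse whose squared operator
norms, from `L²` to `L²` and from `L²` to the `H¹` seminorm, are at most `a` and `b`. -/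
def HasBoundedRightInverse (T : Triangle) (k : ℕ) (a b : ℝ) : Prop :=
  ∃ R : ↥(bubbleQ T (k - 1) ⊓ rmPerp T) →ₗ[ℝ] ↥(bubbleSigma T k), ∀ q,
    div (R q : Matrix (Fin 2) (Fin 2) Poly) = q ∧
    l2NormSq T (entries (R q)) ≤ a * l2NormSq T q.1 ∧
    l2NormSq T (grad (R q)) ≤ b * l2NormSq T q.1

theorem exists_hasBoundedRightInverse (T : Triangle) (k : ℕ) :
    ∃ a b, 0 ≤ a ∧ 0 ≤ b ∧ HasBoundedRightInverse T k a b := by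
  obtain ⟨R, hR⟩ := (div.restrict fun _ => div_mem).exists_rightInverse_of_surjective
    (LinearMap.range_eq_top.2 (surjective_div_restrict fun _ => div_mem (T := T) (k := k)))
  have hinj := (bubbleQ T (k - 1) ⊓ rmPerp T).injective_subtype
  obtain ⟨a, ha, hRa⟩ := exists_l2NormSq_le_mul (T := T)
    (entries ∘ₗ (bubbleSigma T k).subtype ∘ₗ R) hinj
  obtain ⟨b, hb, hRb⟩ := exists_l2NormSq_le_mul (T := T)
    (grad ∘ₗ (bubbleSigma T k).subtype ∘ₗ R) hinj
  exact ⟨a, b, ha, hb, R, fun q =>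
    ⟨congr_arg Subtype.val (LinearMap.congr_fun hR q), hRa q, hRb q⟩⟩

theorem HasBoundedRightInverse.mono {T : Triangle} {k : ℕ} {a b a' b' : ℝ}
    (h : HasBoundedRightInverse T k a b) (ha : a ≤ a') (hb : b ≤ b') :
    HasBoundedRightInverse T k a' b' := by
  obtain ⟨R, hR⟩ := h
  refine ⟨R, fun q => ⟨(hR q).1, (hR q).2.1.trans ?_, (hR q).2.2.trans ?_⟩⟩
  · exact mul_le_mul_of_nonneg_right ha (l2NormSq_nonneg _)
  · exact mul_le_mul_of_nonneg_right hb (l2NormSq_nonneg _)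

theorem HasBoundedRightInverse.of_affineEquiv {S T : Triangle} {k : ℕ} {a b μ ν : ℝ}
    (h : HasBoundedRightInverse S k a b) (ha : 0 ≤ a) (hb : 0 ≤ b) {F : Plane ≃ᵃ[ℝ] Plane}
    (hF : ∀ v, F (S.points v) = T.points v) (hμ : ∀ i j, |jac F i j| ≤ μ)
    (hν : ∀ i j, |jac F.symm i j| ≤ ν) :
    HasBoundedRightInverse T k (64 * a * (μ ^ 4 * ν ^ 2)) (256 * b * (μ * ν) ^ 4) := by
  obtain ⟨R, hR⟩ := h
  have hF' (v) : F.symm (T.points v) = S.points v := F.symm_apply_eq.2 (hF v).symm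
  refine ⟨(piolaMat F).restrict (fun _ => piolaMat_mem_bubbleSigma hF) ∘ₗ R ∘ₗ
    (piolaVec F.symm).restrict (fun _ => piolaVec_mem hF'), fun q => ?_⟩
  set p := (piolaVec F.symm).restrict (fun _ => piolaVec_mem hF') q
  obtain ⟨hdiv, hRa, hRb⟩ := hR p
  have hp := det_mul_l2NormSq_piolaVec_symm_le hF hν q
  refine ⟨?_, ?_, ?_⟩
  · change div (piolaMat F (R p)) = q
    rw [div_piolaMat, hdiv]
    exact piolaVec_symm F q
  · calc l2NormSq T (entries (piolaMat F (R p)))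
        ≤ 16 * μ ^ 4 * (|F.linear.toLinearMap.det| * l2NormSq S (entries (R p))) :=
          l2NormSq_entries_piolaMat_le hF hμ _
      _ ≤ 16 * μ ^ 4 * (|F.linear.toLinearMap.det| * (a * l2NormSq S p.1)) := by gcongr
      _ = 16 * μ ^ 4 * a * (|F.linear.toLinearMap.det| * l2NormSq S p.1) := by ring
      _ ≤ 16 * μ ^ 4 * a * (4 * ν ^ 2 * l2NormSq T q.1) :=
          mul_le_mul_of_nonneg_left hp (by positivity)
      _ = 64 * a * (μ ^ 4 * ν ^ 2) * l2NormSq T q.1 := by ring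
  · calc l2NormSq T (grad (piolaMat F (R p)))
        ≤ 64 * μ ^ 4 * ν ^ 2 * (|F.linear.toLinearMap.det| * l2NormSq S (grad (R p))) :=
          l2NormSq_grad_piolaMat_le hF hμ hν _
      _ ≤ 64 * μ ^ 4 * ν ^ 2 * (|F.linear.toLinearMap.det| * (b * l2NormSq S p.1)) := by gcongr
      _ = 64 * μ ^ 4 * ν ^ 2 * b * (|F.linear.toLinearMap.det| * l2NormSq S p.1) := by ring
      _ ≤ 64 * μ ^ 4 * ν ^ 2 * b * (4 * ν ^ 2 * l2NormSq T q.1) :=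
          mul_le_mul_of_nonneg_left hp (by positivity)
      _ = 256 * b * (μ * ν) ^ 4 * l2NormSq T q.1 := by ring

theorem exists_triangle_closedBall_subset :
    ∃ (S : Triangle) (c : Plane) (r : ℝ), 0 < r ∧ Metric.closedBall c r ⊆ region S := by
  obtain ⟨b⟩ := AffineBasis.exists_affineBasis_of_finiteDimensional (ι := Fin 3) (k := ℝ)
    (P := Plane) (by simp)
  let S : Triangle := ⟨b, b.ind⟩
  obtain ⟨c, hc⟩ := interior_region_nonempty S
  obtain ⟨r, hr, hball⟩ := Metric.nhds_basis_closedBall.mem_iff.1 (mem_interior_iff_mem_nhds.1 hc)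
  exact ⟨S, c, r, hr, hball⟩

theorem exists_forall_hasBoundedRightInverse (k : ℕ) (κ : ℝ) :
    ∃ A B, 0 ≤ A ∧ 0 ≤ B ∧ ∀ T : Triangle, ShapeRegular κ T →
      HasBoundedRightInverse T k (A * Metric.diam (region T) ^ 2) B := by
  obtain ⟨S, c, s, hs, hballS⟩ := exists_triangle_closedBall_subset
  obtain ⟨a, b, ha, hb, hS⟩ := exists_hasBoundedRightInverse S k
  set d := Metric.diam (region S)
  have hd : 0 ≤ d := Metric.diam_nonneg
  refine ⟨16 * a * (κ * d / (2 * s)) ^ 2 / s ^ 2, 256 * b * (κ * d / (2 * s)) ^ 4, by positivity,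
    by positivity, fun T ⟨c', r, hr, hballT, hdiam⟩ => ?_⟩
  set D := Metric.diam (region T)
  have : 0 ≤ D := Metric.diam_nonneg
  obtain ⟨F, hF⟩ := exists_affineEquiv_forall_points_eq S T
  have hF' (v) : F.symm (T.points v) = S.points v := F.symm_apply_eq.2 (hF v).symm
  have hμ := abs_jac_le (Set.mapsTo_iff_image_subset.2 (image_region (F := F) hF).subset)
    (isCompact_region T).isBounded hs hballS
  have hν := abs_jac_le (Set.mapsTo_iff_image_subset.2 (image_region (F := F.symm) hF').subset)
    (isCompact_region S).isBounded hr hballT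
  have hμν : D / (2 * s) * (d / (2 * r)) ≤ κ * d / (2 * s) := by
    rw [div_mul_div_comm, div_le_div_iff₀ (by positivity) (by positivity)]
    calc D * d * (2 * s) ≤ κ * (2 * r) * d * (2 * s) :=
        mul_le_mul_of_nonneg_right (mul_le_mul_of_nonneg_right hdiam hd) (by positivity)
      _ = κ * d * (2 * s * (2 * r)) := by ring
  refine (hS.of_affineEquiv ha hb hF hμ hν).mono ?_ ?_
  · calc 64 * a * ((D / (2 * s)) ^ 4 * (d / (2 * r)) ^ 2)
        = 16 * a * (D / (2 * s) * (d / (2 * r))) ^ 2 / s ^ 2 * D ^ 2 := by field_simp; ring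
      _ ≤ 16 * a * (κ * d / (2 * s)) ^ 2 / s ^ 2 * D ^ 2 := by gcongr
  · gcongr

theorem exists_bounded_rightInverse (k : ℕ) (κ : ℝ) : ∃ C : ℝ, ∀ T : Triangle, ShapeRegular κ T →
    ∃ R : ↥(bubbleQ T (k - 1) ⊓ rmPerp T) →ₗ[ℝ] ↥(bubbleSigma T k), ∀ q,
      div (R q : Matrix (Fin 2) (Fin 2) Poly) = q ∧
      h1Seminorm T (R q) ≤ C * l2Norm T q ∧
      h1Norm T (R q) ≤ C * max 1 (Metric.diam (region T)) * l2Norm T q := by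
  obtain ⟨A, B, hA, hB, h⟩ := exists_forall_hasBoundedRightInverse k κ
  refine ⟨√(A + B), fun T hT => ?_⟩
  obtain ⟨R, hR⟩ := h T hT
  refine ⟨R, fun q => ?_⟩
  obtain ⟨hdiv, hRA, hRB⟩ := hR q
  set D := Metric.diam (region T)
  have hD : 0 ≤ D := Metric.diam_nonneg
  have hq : 0 ≤ l2NormSq T q.1 := l2NormSq_nonneg _
  rw [h1Seminorm_eq, h1Norm_eq, l2Norm_eq]
  refine ⟨hdiv, ?_, ?_⟩
  · rw [← Real.sqrt_mul (by positivity)]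
    refine Real.sqrt_le_sqrt (hRB.trans ?_)
    gcongr
    linarith
  · have hmax : 0 ≤ max 1 D := hD.trans (le_max_right _ _)
    rw [← Real.sqrt_sq hmax, ← Real.sqrt_mul (by positivity), ← Real.sqrt_mul (by positivity)]
    refine Real.sqrt_le_sqrt ((add_le_add hRA hRB).trans ?_)
    calc A * D ^ 2 * l2NormSq T q.1 + B * l2NormSq T q.1
        = (A * D ^ 2 + B * 1 ^ 2) * l2NormSq T q.1 := by ring
      _ ≤ (A * max 1 D ^ 2 + B * max 1 D ^ 2) * l2NormSq T q.1 := by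
          gcongr
          · exact le_max_right _ _
          · exact le_max_left _ _
      _ = (A + B) * max 1 D ^ 2 * l2NormSq T q.1 := by ring

end BubbleComplex

end

open BubbleComplex in
theorem mainTheorem9_general :
    (∀ (k : ℕ), 1 ≤ k → ∀ (T : Triangle),
      ∃ (hU : ∀ u ∈ bubbleU T (k + 2), airy u ∈ bubbleSigma T k)
        (hS : ∀ σ ∈ bubbleSigma T k, div σ ∈ bubbleQ T (k - 1) ⊓ rmPerp T),
        Function.Injective (airy.restrict hU) ∧
        Function.Exact (airy.restrict hU) (div.restrict hS) ∧
        Function.Surjective (div.restrict hS)) ∧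
    (∀ (k : ℕ), 1 ≤ k → ∀ (κ : ℝ), ∃ C : ℝ, ∀ (T : Triangle), ShapeRegular κ T →
      ∃ R : ↥(bubbleQ T (k - 1) ⊓ rmPerp T) →ₗ[ℝ] ↥(bubbleSigma T k),
        ∀ q : ↥(bubbleQ T (k - 1) ⊓ rmPerp T),
          div (R q : Matrix (Fin 2) (Fin 2) Poly) = q ∧
          h1Seminorm T (R q) ≤ C * l2Norm T q ∧
          h1Norm T (R q) ≤ C * max 1 (Metric.diam (region T)) * l2Norm T q) :=
  ⟨fun _ _ _ => ⟨fun _ => airy_mem_bubbleSigma, fun _ => div_mem, injective_airy_restrict _,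
      exact_airy_restrict_div_restrict _ _, surjective_div_restrict _⟩,
    fun k _ κ => exists_bounded_rightInverse k κ⟩

theorem mainTheorem9 :
    -- the bubble sequence is a complex and is exact on every triangle
    (∀ (k : ℕ), 1 ≤ k → ∀ (T : BubbleComplex.Triangle),
      ∃ (hU : ∀ u ∈ BubbleComplex.bubbleU T (k + 2),
            BubbleComplex.airy u ∈ BubbleComplex.bubbleSigma T k)
        (hS : ∀ σ ∈ BubbleComplex.bubbleSigma T k,
            BubbleComplex.div σ ∈ BubbleComplex.bubbleQ T (k - 1) ⊓ BubbleComplex.rmPerp T),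
        Function.Injective (BubbleComplex.airy.restrict hU) ∧
        Function.Exact (BubbleComplex.airy.restrict hU) (BubbleComplex.div.restrict hS) ∧
        Function.Surjective (BubbleComplex.div.restrict hS)) ∧
    -- bounded right inverse of the divergence on bubbles
    (∀ (k : ℕ), 7 ≤ k → ∀ (κ : ℝ), ∃ C : ℝ, ∀ (T : BubbleComplex.Triangle),
      BubbleComplex.ShapeRegular κ T →
      ∃ R : ↥(BubbleComplex.bubbleQ T (k - 1) ⊓ BubbleComplex.rmPerp T) →ₗ[ℝ]
          ↥(BubbleComplex.bubbleSigma T k),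
        ∀ q : ↥(BubbleComplex.bubbleQ T (k - 1) ⊓ BubbleComplex.rmPerp T),
          BubbleComplex.div (R q : Matrix (Fin 2) (Fin 2) BubbleComplex.Poly) = q ∧
          BubbleComplex.h1Seminorm T (R q) ≤ C * BubbleComplex.l2Norm T q ∧
          BubbleComplex.h1Norm T (R q) ≤
            C * max 1 (Metric.diam (BubbleComplex.region T)) * BubbleComplex.l2Norm T q) :=
  ⟨mainTheorem9_general.1, fun k hk κ => mainTheorem9_general.2 k (by omega) κ⟩
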